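/- All locally convex spaces (lcs) are real and Hausdorff. For an lcs $E$ let $\mathrm{eqc}(E^*)$ be the family of all equicontinuous weak-star compact subsets of the dual $E^*$; for $M\in\mathrm{eqc}(E^*)$ let $r_M\colon E\to C(M)$, $r_M(x)(\varphi)=\varphi(x)$, be the restriction operator. A subset $B \subseteq E$ is regarded as the family of functions $r_M(B)$ on $M$. **Families of functions.** A family $F$ of real functions on a set $X$ is *tame* if it is uniformly bounded and contains no independent sequence, where $(f_n)$ is *independent* if there are reals $a<b$ with $\bigcap_{n\in P}f_n^{-1}(-\infty,a)\cap\bigcap_{n\in Q}f_n^{-1}(b,\infty)\neq\emptyset$ for all finite disjoint $P,Q\subset\mathbb N$. If $X$ is a topological space, $F$ is *fragmented* if for every nonempty $A\subseteq X$ and $\varepsilon>0$ there is an open $O\subseteq X$ with $O\cap A\ne\emptyset$ and $|f(x)-f(y)|<\varepsilon$ for all $f\in F$ and $x,y\in O\cap A$. $F$ has the *double limit property* (DLP) if for all sequences $(f_n)$ in $F$ and $(x_m)$ in $X$ the limits $\lim_n\lim_m f_n(x_m)$ and $\lim_m\lim_n f_n(x_m)$ are equal whenever both exist. **The classes.** An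 lcs $E$ is *tame*, $E\in\mathbf{(T)}$ (respectively *Namioka–Phelps*, $E\in\mathbf{(NP)}$; $E\in\mathbf{(DLP)}$) if every bounded $B\subseteq E$ is a tame family (respectively a fragmented family; a family with the DLP) on every $M\in\mathrm{eqc}(E^*)$. A *bornological class* $\mathfrak B$ assigns to each compact Hausdorff space $K$ a separated convex vector bornology $\mathfrak B_K$ on $C(K)$ (a family of subsets that covers $C(K)$ and is closed under subsets, finite unions, sums, scalar multiples, balanced hulls and convex hulls, and whose only member that is a linear subspace is $\{0\}$) such that: every $A\in\mathfrak B_K$ is norm bounded; if $\varphi\colon K_1\to K_2$ is continuous and $A\in\mathfrak B_{K_2}$ then $A\circ\varphi\in\mathfrak B_{K_1}$, and if $\varphi$ is moreover surjective and $A\subseteq C(K_2)$ satisfies $A\circ\varphi\in\mathfrak B_{K_1}$ then $A\in\mathfrak B_{K_2}$; and if $A\in\mathfrak B_K$ then its bipolar $A^{\circ\circ}$ with respect to $C(K)^*$ is in $\mathfrak B_K$. An lcs $E$ is *$\mathfrak B$-small* if $r_M(B)\in\mathfrak B_M$ for every bounded $B\subseteq E$ and every $M\in\mathrm{eqc}(E^*)$.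 **Theorem.** Let $\mathcal P$ be the class of $\mathfrak B$-small lcs for an arbitrary bornological class $\mathfrak B$, or one of the classes $\mathbf{(T)}$, $\mathbf{(NP)}$, $\mathbf{(DLP)}$. Then: 1. if $E\in\mathcal P$, every linear subspace of $E$ is in $\mathcal P$; 2. if $E_1\in\mathcal P$, $E_2$ is an lcs and $f\colon E_1\to E_2$ is a continuous linear map that is *bound covering* (every bounded $B_2\subseteq E_2$ is $f(B_1)$ for some bounded $B_1\subseteq E_1$), then $E_2\in\mathcal P$; 3. arbitrary products of members of $\mathcal P$ are in $\mathcal P$; 4. arbitrary locally convex direct sums of members of $\mathcal P$ (with the finest locally convex topology making all canonical inclusions continuous) are in $\mathcal P$; 5. inverse limits of inverse systems (indexed by a preordered set, with continuous linear bonding maps) of members of $\mathcal P$ are in $\mathcal P$; 6. if $F$ is a dense linear subspace of an lcs $E$ which is *large* (every bounded subset of $E$ is contained in the closure of a bounded subset of $F$) and $F\in\mathcal P$, then $E\in\mathcal P$; 7. in particular, if $V$ is a normed space with $V\in\mathcal P$, then the completion of $V$ is in $\mathcal P$. -/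

import Mathlib

open Filter Topology Uniformity

universe u

namespace TameLCS

/-! ### Families of functions -/

section Families

variable {X : Type*}

/-- A family of real functions is bounded if it is uniformly bounded. -/
def IsBoundedFamily (F : Set (X → ℝ)) : Prop :=
  ∃ C : ℝ, ∀ f ∈ F, ∀ x, |f x| ≤ C

/-- A sequence of real functions on a set is (combinatorially) independent. -/
def IsIndependentSeq (f : ℕ → X → ℝ) : Prop :=
  ∃ a b : ℝ, a < b ∧ ∀ P M : Finset ℕ, Disjoint P M →
    ((⋂ n ∈ P, f n ⁻¹' Set.Iio a) ∩ ⋂ n ∈ M, f n ⁻¹' Set.Ioi b).Nonempty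

/-- A tame family: bounded and without independent sequences. -/
def IsTameFamily (F : Set (X → ℝ)) : Prop :=
  IsBoundedFamily F ∧ ¬ ∃ f : ℕ → X → ℝ, (∀ n, f n ∈ F) ∧ IsIndependentSeq f

/-- A family of functions from a topological space to a uniform space is fragmented: every
nonempty `A` has a nonempty relatively open part which all `f ∈ F` simultaneously map
to `V`-small sets. -/
def IsFragmentedFamily {Y : Type*} [TopologicalSpace X] [UniformSpace Y]
    (F : Set (X → Y)) : Prop :=
  ∀ A : Set X, A.Nonempty → ∀ V ∈ 𝓤 Y, ∃ O : Set X, IsOpen O ∧ (O ∩ A).Nonempty ∧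
    ∀ f ∈ F, ∀ x ∈ O ∩ A, ∀ y ∈ O ∩ A, (f x, f y) ∈ V

/-- Grothendieck's double limit property: the two iterated limits of `f n (x m)` agree
whenever both exist. -/
def HasDLP (F : Set (X → ℝ)) : Prop :=
  ∀ f : ℕ → X → ℝ, (∀ n, f n ∈ F) → ∀ x : ℕ → X, ∀ (g h : ℕ → ℝ) (a b : ℝ),
    (∀ n, Tendsto (fun m => f n (x m)) atTop (𝓝 (g n))) → Tendsto g atTop (𝓝 a) →
    (∀ m, Tendsto (fun n => f n (x m)) atTop (𝓝 (h m))) → Tendsto h atTop (𝓝 b) →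
    a = b

end Families

/-! ### Bornological classes -/

/-- The bornology of the real vector space `V` is a separated convex vector bornology. -/
structure IsSeparatedConvexVectorBornology (V : Type*) [AddCommGroup V] [Module ℝ V]
    [Bornology V] : Prop where
  add : ∀ A B : Set V, Bornology.IsBounded A → Bornology.IsBounded B →
    Bornology.IsBounded (Set.image2 (· + ·) A B)
  smul : ∀ (α : ℝ) (A : Set V), Bornology.IsBounded A →
    Bornology.IsBounded ((fun v => α • v) '' A)
  balancedHull : ∀ A : Set V, Bornology.IsBounded A → Bornology.IsBounded (balancedHull ℝ A)
  convexHull : ∀ A : Set V, Bornology.IsBounded A → Bornology.IsBounded (convexHull ℝ A)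
  separated : ∀ S : Submodule ℝ V, Bornology.IsBounded (S : Set V) → S = ⊥

/-- The bipolar of a subset of a topological vector space, with respect to its dual. -/
def bipolar {V : Type*} [AddCommGroup V] [Module ℝ V] [TopologicalSpace V] (A : Set V) : Set V :=
  {v | ∀ φ : V →L[ℝ] ℝ, (∀ w ∈ A, |φ w| ≤ 1) → |φ v| ≤ 1}

/-- A bornological class: a separated convex vector bornology on the Banach space `C(K, ℝ)`
for every compact Hausdorff space `K`, with boundedness, consistency and bipolarity. The field
`bornology K` is an additional structure, and is not the norm bornology of `C(K, ℝ)`. -/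
structure BornologicalClass where
  bornology : ∀ (K : Type u) [TopologicalSpace K] [CompactSpace K] [T2Space K],
    Bornology C(K, ℝ)
  isSeparatedConvexVectorBornology :
    ∀ (K : Type u) [TopologicalSpace K] [CompactSpace K] [T2Space K],
      @IsSeparatedConvexVectorBornology C(K, ℝ) _ _ (bornology K)
  norm_bounded : ∀ (K : Type u) [TopologicalSpace K] [CompactSpace K] [T2Space K]
    (A : Set C(K, ℝ)), @Bornology.IsBounded _ (bornology K) A → ∃ C : ℝ, ∀ f ∈ A, ‖f‖ ≤ C
  comp : ∀ (K₁ K₂ : Type u) [TopologicalSpace K₁] [CompactSpace K₁] [T2Space K₁]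
    [TopologicalSpace K₂] [CompactSpace K₂] [T2Space K₂] (φ : C(K₁, K₂)) (A : Set C(K₂, ℝ)),
    @Bornology.IsBounded _ (bornology K₂) A →
      @Bornology.IsBounded _ (bornology K₁) ((fun f : C(K₂, ℝ) => f.comp φ) '' A)
  of_comp : ∀ (K₁ K₂ : Type u) [TopologicalSpace K₁] [CompactSpace K₁] [T2Space K₁]
    [TopologicalSpace K₂] [CompactSpace K₂] [T2Space K₂] (φ : C(K₁, K₂)),
    Function.Surjective φ → ∀ A : Set C(K₂, ℝ),
    @Bornology.IsBounded _ (bornology K₁) ((fun f : C(K₂, ℝ) => f.comp φ) '' A) →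
      @Bornology.IsBounded _ (bornology K₂) A
  bipolar : ∀ (K : Type u) [TopologicalSpace K] [CompactSpace K] [T2Space K]
    (A : Set C(K, ℝ)), @Bornology.IsBounded _ (bornology K) A →
      @Bornology.IsBounded _ (bornology K) (TameLCS.bipolar A)

/-! ### Small, tame, Asplund and DLP subsets of a locally convex space

Bounded subsets of a topological vector space are the sets with `Bornology.IsVonNBounded ℝ`. -/

section Spaces

variable {E : Type*} [AddCommGroup E] [Module ℝ E] [TopologicalSpace E]

variable (E) in
/-- The equicontinuous weak-star compact subsets of the dual of `E`. -/
def eqc : Set (TopologicalSpace.Compacts (WeakDual ℝ E)) :=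
  {M | Equicontinuous fun (φ : M) (x : E) => (φ : WeakDual ℝ E) x}

/-- The restriction operator `E → C(M)`, sending `x` to `φ ↦ φ x`. -/
noncomputable def restriction (M : TopologicalSpace.Compacts (WeakDual ℝ E)) (x : E) : C(M, ℝ) where
  toFun φ := (φ : WeakDual ℝ E) x
  continuous_toFun := (WeakDual.eval_continuous x).comp continuous_subtype_val

/-- The subset `B` of `E`, viewed as a family of functions on `M`. -/
def familyOn (M : TopologicalSpace.Compacts (WeakDual ℝ E)) (B : Set E) : Set (M → ℝ) :=
  (fun x => ⇑(restriction M x)) '' B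

/-- A bounded subset is tame if it is a tame family on each equicontinuous weak-star compact
set of functionals. -/
def IsTameSubset (B : Set E) : Prop :=
  Bornology.IsVonNBounded ℝ B ∧ ∀ M ∈ eqc E, IsTameFamily (familyOn M B)

/-- A bounded subset is Asplund if it is a fragmented family on each equicontinuous weak-star
compact set of functionals. -/
def IsAsplundSubset (B : Set E) : Prop :=
  Bornology.IsVonNBounded ℝ B ∧ ∀ M ∈ eqc E, IsFragmentedFamily (familyOn M B)

/-- A bounded subset is DLP if it has the double limit property on each equicontinuous
weak-star compact set of functionals. -/
def IsDLPSubset (B : Set E) : Prop :=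
  Bornology.IsVonNBounded ℝ B ∧ ∀ M ∈ eqc E, HasDLP (familyOn M B)

end Spaces

/-- The bounded subset `B` of `E` is small for the bornological class `𝔅`. -/
def BornologicalClass.IsSmallSubset (𝔅 : BornologicalClass.{u}) {E : Type u} [AddCommGroup E]
    [Module ℝ E] [TopologicalSpace E] (B : Set E) : Prop :=
  Bornology.IsVonNBounded ℝ B ∧
    ∀ M ∈ eqc E, @Bornology.IsBounded _ (𝔅.bornology M) (restriction M '' B)

/-- `E` is `𝔅`-small. -/
def BornologicalClass.IsSmall (𝔅 : BornologicalClass.{u}) (E : Type u) [AddCommGroup E]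
    [Module ℝ E] [TopologicalSpace E] : Prop :=
  ∀ B : Set E, Bornology.IsVonNBounded ℝ B → 𝔅.IsSmallSubset B

/-- `E` is tame, that is, `E` belongs to **(T)**. -/
def IsTame (E : Type u) [AddCommGroup E] [Module ℝ E] [TopologicalSpace E] : Prop :=
  ∀ B : Set E, Bornology.IsVonNBounded ℝ B → IsTameSubset B

/-- `E` is a Namioka-Phelps space, that is, `E` belongs to **(NP)**. -/
def IsNamiokaPhelps (E : Type u) [AddCommGroup E] [Module ℝ E] [TopologicalSpace E] : Prop :=
  ∀ B : Set E, Bornology.IsVonNBounded ℝ B → IsAsplundSubset B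

/-- Equivalent form of the definition of Namioka-Phelps spaces: every equicontinuous weak-star
compact set of functionals is fragmented with respect to the weak-star topology and the strong
uniformity of the dual. -/
theorem isNamiokaPhelps_iff (E : Type u) [AddCommGroup E] [Module ℝ E] [TopologicalSpace E]
    [IsTopologicalAddGroup E] [ContinuousSMul ℝ E] :
    IsNamiokaPhelps E ↔ ∀ M ∈ eqc E,
      IsFragmentedFamily {fun φ : M => (WeakDual.toStrongDual (φ : WeakDual ℝ E) : E →L[ℝ] ℝ)} := by
  constructor
  · intro h M hM A hA V hV
    rw [uniformity_eq_comap_nhds_zero, mem_comap] at hV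
    obtain ⟨W, hW, hWV⟩ := hV
    obtain ⟨⟨B, U⟩, ⟨hB, hU⟩, hBU⟩ := ContinuousLinearMap.hasBasis_nhds_zero.mem_iff.1 hW
    have hU' : (fun p : ℝ × ℝ => p.2 - p.1) ⁻¹' U ∈ 𝓤 ℝ := by
      rw [uniformity_eq_comap_nhds_zero]
      exact preimage_mem_comap hU
    obtain ⟨O, hO, hne, hs⟩ := (h B hB).2 M hM A hA _ hU'
    refine ⟨O, hO, hne, ?_⟩
    rintro f rfl x hx y hy
    exact hWV (hBU fun b hb => hs _ ⟨b, hb, rfl⟩ x hx y hy)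
  · intro h B hB
    refine ⟨hB, fun M hM A hA V hV => ?_⟩
    rw [uniformity_eq_comap_nhds_zero, mem_comap] at hV
    obtain ⟨U, hU, hUV⟩ := hV
    have hW : {f : E →L[ℝ] ℝ | ∀ b ∈ B, f b ∈ U} ∈ 𝓝 (0 : E →L[ℝ] ℝ) :=
      ContinuousLinearMap.hasBasis_nhds_zero.mem_of_mem (i := (B, U)) ⟨hB, hU⟩
    have hW' : (fun p : (E →L[ℝ] ℝ) × (E →L[ℝ] ℝ) => p.2 - p.1) ⁻¹'
        {f : E →L[ℝ] ℝ | ∀ b ∈ B, f b ∈ U} ∈ 𝓤 (E →L[ℝ] ℝ) := by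
      rw [uniformity_eq_comap_nhds_zero]
      exact preimage_mem_comap hW
    obtain ⟨O, hO, hne, hs⟩ := h M hM A hA _ hW'
    refine ⟨O, hO, hne, ?_⟩
    rintro _ ⟨b, hb, rfl⟩ x hx y hy
    exact hUV (hs _ rfl x hx y hy b hb)

/-- `E` belongs to **(DLP)**. -/
def IsDLP (E : Type u) [AddCommGroup E] [Module ℝ E] [TopologicalSpace E] : Prop :=
  ∀ B : Set E, Bornology.IsVonNBounded ℝ B → IsDLPSubset B

/-! ### Constructions with locally convex spaces -/

/-- A continuous linear map is bound covering if every bounded subset of its target is the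
image of a bounded subset of its source. -/
def IsBoundCovering {E₁ E₂ : Type*} [AddCommGroup E₁] [Module ℝ E₁] [TopologicalSpace E₁]
    [AddCommGroup E₂] [Module ℝ E₂] [TopologicalSpace E₂] (f : E₁ →L[ℝ] E₂) : Prop :=
  ∀ B₂ : Set E₂, Bornology.IsVonNBounded ℝ B₂ →
    ∃ B₁ : Set E₁, Bornology.IsVonNBounded ℝ B₁ ∧ f '' B₁ = B₂

/-- A subspace `F` of `E` is large if every bounded subset of `E` is contained in the closure
of a bounded subset of `F`. -/
def IsLarge {E : Type*} [AddCommGroup E] [Module ℝ E] [TopologicalSpace E]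
    (F : Submodule ℝ E) : Prop :=
  ∀ B : Set E, Bornology.IsVonNBounded ℝ B →
    ∃ C : Set F, Bornology.IsVonNBounded ℝ C ∧ B ⊆ closure ((fun x : F => (x : E)) '' C)

/-- The inverse limit of a system of linear maps `f : E j → E i`, `i ≤ j`, as a subspace
of the product. -/
def inverseLimit {ι : Type*} [Preorder ι] {E : ι → Type*} [∀ i, AddCommGroup (E i)]
    [∀ i, Module ℝ (E i)] [∀ i, TopologicalSpace (E i)]
    (f : ∀ ⦃i j : ι⦄, i ≤ j → E j →L[ℝ] E i) : Submodule ℝ (∀ i, E i) where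
  carrier := {x | ∀ ⦃i j : ι⦄ (h : i ≤ j), f h (x j) = x i}
  add_mem' {x y} hx hy i j h := by simp [hx h, hy h]
  zero_mem' i j h := by simp
  smul_mem' c x hx i j h := by simp [hx h]

section DirectSum

variable {ι : Type*} (E : ι → Type*) [∀ i, AddCommGroup (E i)] [∀ i, Module ℝ (E i)]

/-- The algebraic direct sum, to be given the locally convex direct sum topology. -/
def LCDirectSum : Type _ := DirectSum ι E

instance : AddCommGroup (LCDirectSum E) := inferInstanceAs (AddCommGroup (DirectSum ι E))

instance : Module ℝ (LCDirectSum E) := inferInstanceAs (Module ℝ (DirectSum ι E))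

namespace LCDirectSum

open Classical in
/-- The canonical inclusion of a summand. -/
noncomputable def incl (i : ι) : E i →ₗ[ℝ] LCDirectSum E := DirectSum.lof ℝ ι E i

/-- The canonical projection to a summand. -/
def proj (i : ι) : LCDirectSum E →ₗ[ℝ] E i := DirectSum.component ℝ ι E i

variable [∀ i, TopologicalSpace (E i)]

/-- The locally convex vector topologies on the direct sum that make all canonical inclusions
continuous. -/
def admissible : Set (TopologicalSpace (LCDirectSum E)) :=
  {t | @IsTopologicalAddGroup _ t _ ∧ @ContinuousSMul ℝ _ _ _ t ∧
    @LocallyConvexSpace ℝ _ _ _ _ _ t ∧ ∀ i, @Continuous _ _ _ t (incl E i)}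

/-- The locally convex direct sum topology: the finest locally convex vector topology that makes
all canonical inclusions continuous. (Finer topologies are smaller in the order of
`TopologicalSpace`; the lemma `isLeast_admissible` says that the infimum is attained.) -/
instance : TopologicalSpace (LCDirectSum E) := sInf (admissible E)

instance : IsTopologicalAddGroup (LCDirectSum E) := topologicalAddGroup_sInf fun _ ht => ht.1

instance : ContinuousSMul ℝ (LCDirectSum E) := continuousSMul_sInf fun _ ht => ht.2.1

instance : LocallyConvexSpace ℝ (LCDirectSum E) := LocallyConvexSpace.sInf fun _ ht => ht.2.2.1

theorem isLeast_admissible : IsLeast (admissible E) (inferInstance : TopologicalSpace _) :=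
  ⟨⟨inferInstance, inferInstance, inferInstance,
    fun i => continuous_sInf_rng.2 fun _ ht => ht.2.2.2 i⟩, fun _ ht => sInf_le ht⟩

theorem continuous_proj [∀ i, IsTopologicalAddGroup (E i)] [∀ i, ContinuousSMul ℝ (E i)]
    [∀ i, LocallyConvexSpace ℝ (E i)] (i : ι) : Continuous (proj E i) := by
  classical
  refine continuous_iff_le_induced.2 (sInf_le ⟨topologicalAddGroup_induced _,
    continuousSMul_induced _, LocallyConvexSpace.induced _, fun j => ?_⟩)
  refine continuous_induced_rng.2 ?_
  by_cases hij : j = i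
  · subst hij
    have : (proj E j ∘ incl E j : E j → E j) = id := by
      funext x
      exact DirectSum.component.lof_self ℝ j x
    rw [this]
    exact continuous_id
  · have : (proj E i ∘ incl E j : E j → E i) = fun _ => 0 := by
      funext x
      exact (DirectSum.component.of ℝ i j x).trans (dif_neg hij)
    rw [this]
    exact continuous_const

instance [∀ i, IsTopologicalAddGroup (E i)] [∀ i, ContinuousSMul ℝ (E i)]
    [∀ i, LocallyConvexSpace ℝ (E i)] [∀ i, T2Space (E i)] : T2Space (LCDirectSum E) := by
  refine T2Space.of_injective_continuous (f := fun x i => proj E i x) ?_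
    (continuous_pi fun i => continuous_proj E i)
  intro x y hxy
  exact DFinsupp.ext fun i => congrFun hxy i

end LCDirectSum

end DirectSum

/-! ### Stability properties of a class of locally convex spaces

A class `P` of locally convex spaces is a property of topological real vector spaces. It is only
ever applied to real Hausdorff locally convex spaces. -/

section Stability

variable (P : ∀ (E : Type u) [AddCommGroup E] [Module ℝ E] [TopologicalSpace E], Prop)

def ClosedUnderSubspaces : Prop :=
  ∀ (E : Type u) [AddCommGroup E] [Module ℝ E] [TopologicalSpace E] [IsTopologicalAddGroup E]
    [ContinuousSMul ℝ E] [LocallyConvexSpace ℝ E] [T2Space E] (F : Submodule ℝ E),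
    P E → P F

def ClosedUnderBoundCoveringMaps : Prop :=
  ∀ (E₁ : Type u) [AddCommGroup E₁] [Module ℝ E₁] [TopologicalSpace E₁]
    [IsTopologicalAddGroup E₁] [ContinuousSMul ℝ E₁] [LocallyConvexSpace ℝ E₁] [T2Space E₁]
    (E₂ : Type u) [AddCommGroup E₂] [Module ℝ E₂] [TopologicalSpace E₂]
    [IsTopologicalAddGroup E₂] [ContinuousSMul ℝ E₂] [LocallyConvexSpace ℝ E₂] [T2Space E₂]
    (f : E₁ →L[ℝ] E₂), IsBoundCovering f → P E₁ → P E₂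

def ClosedUnderProducts : Prop :=
  ∀ (ι : Type u) (E : ι → Type u) [∀ i, AddCommGroup (E i)] [∀ i, Module ℝ (E i)]
    [∀ i, TopologicalSpace (E i)] [∀ i, IsTopologicalAddGroup (E i)]
    [∀ i, ContinuousSMul ℝ (E i)] [∀ i, LocallyConvexSpace ℝ (E i)] [∀ i, T2Space (E i)],
    (∀ i, P (E i)) → P (∀ i, E i)

def ClosedUnderDirectSums : Prop :=
  ∀ (ι : Type u) (E : ι → Type u) [∀ i, AddCommGroup (E i)] [∀ i, Module ℝ (E i)]
    [∀ i, TopologicalSpace (E i)] [∀ i, IsTopologicalAddGroup (E i)]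
    [∀ i, ContinuousSMul ℝ (E i)] [∀ i, LocallyConvexSpace ℝ (E i)] [∀ i, T2Space (E i)],
    (∀ i, P (E i)) → P (LCDirectSum E)

def ClosedUnderInverseLimits : Prop :=
  ∀ (ι : Type u) [Preorder ι] (E : ι → Type u) [∀ i, AddCommGroup (E i)]
    [∀ i, Module ℝ (E i)] [∀ i, TopologicalSpace (E i)] [∀ i, IsTopologicalAddGroup (E i)]
    [∀ i, ContinuousSMul ℝ (E i)] [∀ i, LocallyConvexSpace ℝ (E i)] [∀ i, T2Space (E i)]
    (f : ∀ ⦃i j : ι⦄, i ≤ j → E j →L[ℝ] E i), InverseSystem (fun _ _ h => f h) →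
    (∀ i, P (E i)) → P (inverseLimit f)

def PassesFromLargeDenseSubspaces : Prop :=
  ∀ (E : Type u) [AddCommGroup E] [Module ℝ E] [TopologicalSpace E] [IsTopologicalAddGroup E]
    [ContinuousSMul ℝ E] [LocallyConvexSpace ℝ E] [T2Space E] (F : Submodule ℝ E),
    Dense (F : Set E) → IsLarge F → P F → P E

def PassesToCompletionsOfNormedSpaces : Prop :=
  ∀ (V : Type u) [NormedAddCommGroup V] [NormedSpace ℝ V], P V → P (UniformSpace.Completion V)

/-- All the stability properties together. -/
structure IsStable : Prop where
  subspaces : ClosedUnderSubspaces P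
  boundCoveringMaps : ClosedUnderBoundCoveringMaps P
  products : ClosedUnderProducts P
  directSums : ClosedUnderDirectSums P
  inverseLimits : ClosedUnderInverseLimits P
  largeDenseSubspaces : PassesFromLargeDenseSubspaces P
  completions : PassesToCompletionsOfNormedSpaces P

end Stability

end TameLCS

/-!
The four kinds of classes are handled together. Each of them says that every bounded `B ⊆ E` restricts
to a member of some class `S` of subsets of `C(M, ℝ)`, for every equicontinuous weak-star compact `M`.
All the stability properties follow as soon as `S` is *admissible* (`IsAdmissibleClass`): it is closed
under subsets, sums, composition with continuous maps (in both directions for surjections) and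
uniform closure, and contains `{0}`. Convex hulls and bipolars are not needed, which is what makes
the argument uniform: closure under convex hulls is a deep fact for tame and for DLP families.

* A continuous linear map `T : E → F` pulls `M` back to its image under the transpose, and the functions
  given by `T x` on `M` are those given by `x` on this image, composed with the transpose. This
  settles bound covering maps.
* For a subspace, an equicontinuous compact set of functionals lifts to the whole space by the
  Hahn-Banach and Banach-Alaoglu theorems (`exists_pullback_subtypeL_eq`), and `S` descends along
  the surjection.
* On a product an equicontinuous set only involves finitely many coordinates, and in a locally
  convex direct sum a bounded set lives in finitely many summands; in both cases `B` consists, as far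
  as `M` can see, of finite sums of vectors from the factors (`IsSmallFor.of_sum`). Inverse limits are
  subspaces of products.
* The restriction map `E → C(M, ℝ)` is continuous, so large subspaces and completions are covered by
  closure under uniform limits.

It remains to see that the classes are admissible. For a bornological class, the bipolar contains the
closure. For fragmented families the point is descent along surjections, where a minimal closed
set over a given closed set is used. For the double limit property, sums and limits are treated by
passing to double subsequences for which all iterated limits exist. For tame families the
point is closure under sums, which rests on Rosenthal's dichotomy for sequences of pairs of sets
(`exists_strictMono_not_frequently_or_independent`): a sequence in a bounded family without
independent sequences has subsequences of arbitrarily small pointwise oscillation, whereas on a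
compact space the oscillation of an independent sequence of continuous functions stays bounded below
along all subsequences. The dichotomy is proved
with a free ultrafilter on `ℕ`, whose diagonal intersections replace the infinite Ramsey theorem.
-/

namespace TameLCS


/-! ### Equicontinuous weak-star compact sets of functionals -/

section Dual

variable {E F : Type*} [AddCommGroup E] [Module ℝ E] [TopologicalSpace E]
  [AddCommGroup F] [Module ℝ F] [TopologicalSpace F]

/-- The transpose of a continuous linear map, as a continuous map between weak-star duals. -/
noncomputable def weakTranspose (T : E →L[ℝ] F) : C(WeakDual ℝ F, WeakDual ℝ E) where
  toFun φ := StrongDual.toWeakDual ((WeakDual.toStrongDual φ).comp T)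
  continuous_toFun := WeakDual.continuous_of_continuous_eval fun x => WeakDual.eval_continuous (T x)

@[simp]
theorem weakTranspose_apply (T : E →L[ℝ] F) (φ : WeakDual ℝ F) (x : E) :
    weakTranspose T φ x = φ (T x) := rfl

/-- The image of a weak-star compact set under the transpose of a continuous linear map. -/
noncomputable def pullback (T : E →L[ℝ] F) (M : TopologicalSpace.Compacts (WeakDual ℝ F)) :
    TopologicalSpace.Compacts (WeakDual ℝ E) :=
  M.map (weakTranspose T) (weakTranspose T).continuous

/-- The canonical map of a weak-star compact set onto its image under a transpose. -/
noncomputable def toPullback (T : E →L[ℝ] F) (M : TopologicalSpace.Compacts (WeakDual ℝ F)) :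
    C(M, pullback T M) where
  toFun φ := ⟨weakTranspose T φ, Set.mem_image_of_mem _ φ.2⟩
  continuous_toFun :=
    ((weakTranspose T).continuous.comp continuous_subtype_val).subtype_mk _

theorem toPullback_surjective (T : E →L[ℝ] F) (M : TopologicalSpace.Compacts (WeakDual ℝ F)) :
    Function.Surjective (toPullback T M) := by
  rintro ⟨_, φ, hφ, rfl⟩
  exact ⟨⟨φ, hφ⟩, rfl⟩

theorem restriction_pullback (T : E →L[ℝ] F) (M : TopologicalSpace.Compacts (WeakDual ℝ F))
    (x : E) : (restriction (pullback T M) x).comp (toPullback T M) = restriction M (T x) := rfl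

theorem image_restriction_pullback (T : E →L[ℝ] F)
    (M : TopologicalSpace.Compacts (WeakDual ℝ F)) (B : Set E) :
    (fun f : C(pullback T M, ℝ) => f.comp (toPullback T M)) '' (restriction (pullback T M) '' B) =
      restriction M '' (T '' B) := by
  simp only [Set.image_image, restriction_pullback]

theorem pullback_mem_eqc (T : E →L[ℝ] F) {M : TopologicalSpace.Compacts (WeakDual ℝ F)}
    (hM : M ∈ eqc F) : pullback T M ∈ eqc E := by
  intro x U hU
  filter_upwards [T.continuous.continuousAt.eventually (hM (T x) U hU)] with y hy
  rintro ⟨_, φ, hφ, rfl⟩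
  exact hy ⟨φ, hφ⟩

/-- The functionals in an equicontinuous set are jointly small on a neighbourhood of zero. -/
theorem exists_nhds_forall_abs_lt_one {M : TopologicalSpace.Compacts (WeakDual ℝ E)}
    (hM : M ∈ eqc E) : ∃ U ∈ 𝓝 (0 : E), ∀ x ∈ U, ∀ φ ∈ M, |φ x| < 1 := by
  refine ⟨_, hM 0 _ (Metric.dist_mem_uniformity one_pos), fun x hx φ hφ => ?_⟩
  simpa [Real.dist_eq] using hx ⟨φ, hφ⟩

/-- A bounded set of vectors is uniformly bounded on an equicontinuous set of functionals. -/
theorem exists_abs_le_of_isVonNBounded {M : TopologicalSpace.Compacts (WeakDual ℝ E)}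
    (hM : M ∈ eqc E) {B : Set E} (hB : Bornology.IsVonNBounded ℝ B) :
    ∃ C : ℝ, ∀ x ∈ B, ∀ φ ∈ M, |φ x| ≤ C := by
  obtain ⟨U, hU, hUM⟩ := exists_nhds_forall_abs_lt_one hM
  obtain ⟨r, hr, hrB⟩ := (hB hU).exists_pos
  refine ⟨r, fun x hx φ hφ => ?_⟩
  obtain ⟨y, hy, rfl⟩ := hrB r (le_abs_self r) hx
  have := hUM y hy φ hφ
  simp only [map_smul, smul_eq_mul, abs_mul, abs_of_pos hr]
  nlinarith

theorem continuous_restriction {M : TopologicalSpace.Compacts (WeakDual ℝ E)} (hM : M ∈ eqc E) :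
    Continuous (restriction M) := by
  refine continuous_iff_continuousAt.2 fun x => Metric.tendsto_nhds.2 fun ε hε => ?_
  filter_upwards [hM x _ (Metric.dist_mem_uniformity hε)] with y hy
  rw [dist_comm, ContinuousMap.dist_lt_iff hε]
  exact hy

/-- The Banach-Alaoglu theorem: the functionals dominated by a continuous seminorm form a weak-star
compact set. -/
theorem isCompact_setOf_forall_abs_le [IsTopologicalAddGroup E] {p : Seminorm ℝ E}
    (hp : Continuous p) : IsCompact {φ : WeakDual ℝ E | ∀ x, |φ x| ≤ p x} := by
  have hind : IsInducing fun (φ : WeakDual ℝ E) (x : E) => φ x := ⟨rfl⟩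
  rw [hind.isCompact_iff]
  have hlin : IsClosed {f : E → ℝ | (∀ x y, f (x + y) = f x + f y) ∧
      ∀ (c : ℝ) x, f (c • x) = c * f x} := by
    simp only [Set.ofPred_and, Set.ofPred_forall]
    exact (isClosed_iInter fun x => isClosed_iInter fun y =>
      isClosed_eq (by fun_prop) (by fun_prop)).inter
      (isClosed_iInter fun c => isClosed_iInter fun x => isClosed_eq (by fun_prop) (by fun_prop))
  convert (isCompact_univ_pi fun x : E => isCompact_Icc (a := -p x) (b := p x)).inter_right hlin
    using 1
  ext f
  constructor
  · rintro ⟨φ, hφ, rfl⟩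
    exact ⟨fun x _ => abs_le.1 (hφ x), map_add φ, fun c x => by simp⟩
  · rintro ⟨hf, hadd, hsmul⟩
    have hle : ∀ x, |f x| ≤ p x := fun x => abs_le.2 (hf x trivial)
    let g : E →ₗ[ℝ] ℝ := ⟨⟨f, hadd⟩, hsmul⟩
    have hg : Continuous g := by
      refine continuous_of_continuousAt_zero g ?_
      rw [ContinuousAt, map_zero]
      exact squeeze_zero_norm hle (by simpa using hp.tendsto 0)
    exact ⟨StrongDual.toWeakDual ⟨g, hg⟩, hle, rfl⟩

theorem mem_eqc_of_forall_abs_le [IsTopologicalAddGroup E] {p : Seminorm ℝ E} (hp : Continuous p)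
    {M : TopologicalSpace.Compacts (WeakDual ℝ E)} (hM : ∀ φ ∈ M, ∀ x, |φ x| ≤ p x) :
    M ∈ eqc E := by
  intro x U hU
  obtain ⟨ε, hε, hU⟩ := Metric.mem_uniformity_dist.1 hU
  have h0 : Tendsto (fun y => p (x - y)) (𝓝 x) (𝓝 0) := by
    have : Continuous fun y => p (x - y) := by fun_prop
    simpa using this.tendsto x
  filter_upwards [h0.eventually_lt_const hε] with y hy φ
  refine hU ?_
  rw [Real.dist_eq, ← map_sub]
  exact (hM φ φ.2 _).trans_lt hy

theorem exists_seminorm_of_mem_eqc [IsTopologicalAddGroup E] [ContinuousSMul ℝ E]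
    {M : TopologicalSpace.Compacts (WeakDual ℝ E)} (hM : M ∈ eqc E) :
    ∃ p : Seminorm ℝ E, Continuous p ∧ ∀ φ ∈ M, ∀ x, |φ x| ≤ p x := by
  let := IsTopologicalAddGroup.rightUniformSpace E
  have := isUniformAddGroup_of_addCommGroup (G := E)
  have h := ((norm_withSeminorms ℝ ℝ).equicontinuous_TFAE
    fun φ : M => (WeakDual.toStrongDual (φ : WeakDual ℝ E) : E →L[ℝ] ℝ).toLinearMap).out 1 3
  obtain ⟨p, hp, hle⟩ := h.1 hM 0
  exact ⟨p, hp, fun φ hφ x => hle ⟨φ, hφ⟩ x⟩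

/-- By the Hahn-Banach and Banach-Alaoglu theorems, every equicontinuous weak-star compact set of
functionals on a subspace is the set of restrictions of an equicontinuous weak-star compact set
of functionals on the whole space. -/
theorem exists_pullback_subtypeL_eq [IsTopologicalAddGroup E] [ContinuousSMul ℝ E]
    [LocallyConvexSpace ℝ E] (G : Submodule ℝ E)
    {M : TopologicalSpace.Compacts (WeakDual ℝ G)} (hM : M ∈ eqc G) :
    ∃ N ∈ eqc E, pullback G.subtypeL N = M := by
  obtain ⟨q, hq, hqM⟩ := exists_seminorm_of_mem_eqc hM
  obtain ⟨p, hp, hqp⟩ :=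
    Seminorm.exists_le_comp_of_isInducing (f := G.subtype) hq IsInducing.subtypeVal
  let N : TopologicalSpace.Compacts (WeakDual ℝ E) :=
    ⟨{φ | ∀ x, |φ x| ≤ p x} ∩ weakTranspose G.subtypeL ⁻¹' M,
      (isCompact_setOf_forall_abs_le hp).inter_right
        (M.isCompact.isClosed.preimage (weakTranspose G.subtypeL).continuous)⟩
  refine ⟨N, mem_eqc_of_forall_abs_le hp fun φ hφ => hφ.1,
    TopologicalSpace.Compacts.ext (Set.Subset.antisymm ?_ ?_)⟩
  · rintro _ ⟨φ, hφ, rfl⟩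
    exact hφ.2
  · intro φ hφ
    obtain ⟨ψ, hψ, hψp⟩ := Module.Dual.exists_continuous_extension_of_le_seminorm (𝕜 := ℝ) G
      (WeakDual.toStrongDual φ : G →L[ℝ] ℝ).toLinearMap hp fun x => (hqM φ hφ x).trans (hqp x)
    have hψφ : weakTranspose G.subtypeL (StrongDual.toWeakDual ψ) = φ :=
      DFunLike.ext _ _ fun x => hψ x
    exact ⟨StrongDual.toWeakDual ψ, ⟨hψp, by rwa [Set.mem_preimage, hψφ]⟩, hψφ⟩

end Dual

/-! ### Admissible classes of families of continuous functions -/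

/-- The properties of a class `S` of subsets of the spaces `C(K, ℝ)` from which all the stability
properties of the corresponding class of locally convex spaces follow. -/
structure IsAdmissibleClass (S : ∀ (K : Type u) [TopologicalSpace K] [CompactSpace K] [T2Space K],
    Set C(K, ℝ) → Prop) : Prop where
  mono : ∀ (K : Type u) [TopologicalSpace K] [CompactSpace K] [T2Space K] (A B : Set C(K, ℝ)),
    A ⊆ B → S K B → S K A
  zero : ∀ (K : Type u) [TopologicalSpace K] [CompactSpace K] [T2Space K], S K {0}
  add : ∀ (K : Type u) [TopologicalSpace K] [CompactSpace K] [T2Space K] (A B : Set C(K, ℝ)),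
    S K A → S K B → S K (Set.image2 (· + ·) A B)
  comp : ∀ (K₁ K₂ : Type u) [TopologicalSpace K₁] [CompactSpace K₁] [T2Space K₁]
    [TopologicalSpace K₂] [CompactSpace K₂] [T2Space K₂] (φ : C(K₁, K₂)) (A : Set C(K₂, ℝ)),
    S K₂ A → S K₁ ((fun f : C(K₂, ℝ) => f.comp φ) '' A)
  of_comp : ∀ (K₁ K₂ : Type u) [TopologicalSpace K₁] [CompactSpace K₁] [T2Space K₁]
    [TopologicalSpace K₂] [CompactSpace K₂] [T2Space K₂] (φ : C(K₁, K₂)),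
    Function.Surjective φ → ∀ A : Set C(K₂, ℝ),
    S K₁ ((fun f : C(K₂, ℝ) => f.comp φ) '' A) → S K₂ A
  closure : ∀ (K : Type u) [TopologicalSpace K] [CompactSpace K] [T2Space K] (A : Set C(K, ℝ)),
    S K A → S K (closure A)

/-- `E` is small for the class `S`: each bounded subset of `E` restricts to a member of `S` on each
equicontinuous weak-star compact set of functionals. -/
def IsSmallFor (S : ∀ (K : Type u) [TopologicalSpace K] [CompactSpace K] [T2Space K],
    Set C(K, ℝ) → Prop) (E : Type u) [AddCommGroup E] [Module ℝ E] [TopologicalSpace E] : Prop :=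
  ∀ B : Set E, Bornology.IsVonNBounded ℝ B → ∀ M ∈ eqc E, S M (restriction M '' B)

section Stability

variable {S : ∀ (K : Type u) [TopologicalSpace K] [CompactSpace K] [T2Space K],
  Set C(K, ℝ) → Prop}

theorem IsAdmissibleClass.finsetSum (hS : IsAdmissibleClass S) {K : Type u} [TopologicalSpace K]
    [CompactSpace K] [T2Space K] {ι : Type*} (J : Finset ι) (A : ι → Set C(K, ℝ))
    (hA : ∀ i ∈ J, S K (A i)) :
    S K {f | ∃ g : ι → C(K, ℝ), (∀ i ∈ J, g i ∈ A i) ∧ f = ∑ i ∈ J, g i} := by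
  classical
  induction J using Finset.induction_on with
  | empty => exact hS.mono K _ _ (by rintro f ⟨g, -, rfl⟩; simp) (hS.zero K)
  | insert j J hj ih =>
    refine hS.mono K _ _ ?_ (hS.add K _ _ (hA j (J.mem_insert_self j))
      (ih fun i hi => hA i (Finset.mem_insert_of_mem hi)))
    rintro f ⟨g, hg, rfl⟩
    rw [Finset.sum_insert hj]
    exact ⟨g j, hg j (J.mem_insert_self j), _,
      ⟨g, fun i hi => hg i (Finset.mem_insert_of_mem hi), rfl⟩, rfl⟩

/-- The image of a bounded set under a continuous linear map from a small space is small, even if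
the target is not. -/
theorem IsSmallFor.image (hS : IsAdmissibleClass S) {E F : Type u} [AddCommGroup E] [Module ℝ E]
    [TopologicalSpace E] [AddCommGroup F] [Module ℝ F] [TopologicalSpace F] (hE : IsSmallFor S E)
    (T : E →L[ℝ] F) {B : Set E} (hB : Bornology.IsVonNBounded ℝ B)
    {M : TopologicalSpace.Compacts (WeakDual ℝ F)} (hM : M ∈ eqc F) :
    S M (restriction M '' (T '' B)) := by
  rw [← image_restriction_pullback]
  exact hS.comp _ _ _ _ (hE B hB _ (pullback_mem_eqc T hM))

theorem IsSmallFor.of_isBoundCovering (hS : IsAdmissibleClass S) {E F : Type u} [AddCommGroup E]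
    [Module ℝ E] [TopologicalSpace E] [AddCommGroup F] [Module ℝ F] [TopologicalSpace F]
    (hE : IsSmallFor S E) (T : E →L[ℝ] F) (hT : IsBoundCovering T) : IsSmallFor S F := by
  intro B hB M hM
  obtain ⟨C, hC, rfl⟩ := hT B hB
  exact hE.image hS T hC hM

theorem IsSmallFor.submodule (hS : IsAdmissibleClass S) {E : Type u} [AddCommGroup E] [Module ℝ E]
    [TopologicalSpace E] [IsTopologicalAddGroup E] [ContinuousSMul ℝ E] [LocallyConvexSpace ℝ E]
    (hE : IsSmallFor S E) (G : Submodule ℝ E) : IsSmallFor S G := by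
  intro B hB M hM
  obtain ⟨N, hN, rfl⟩ := exists_pullback_subtypeL_eq G hM
  refine hS.of_comp _ _ (toPullback G.subtypeL N) (toPullback_surjective _ _) _ ?_
  rw [image_restriction_pullback]
  exact hE _ (hB.image G.subtypeL) N hN

/-- If on `M` the vectors of `B` are finite sums of vectors taken from bounded subsets of small
spaces, then `B` is small on `M`. -/
theorem IsSmallFor.of_sum (hS : IsAdmissibleClass S) {ι : Type*} {E : ι → Type u}
    [∀ i, AddCommGroup (E i)] [∀ i, Module ℝ (E i)] [∀ i, TopologicalSpace (E i)]
    (hE : ∀ i, IsSmallFor S (E i)) {F : Type u} [AddCommGroup F] [Module ℝ F] [TopologicalSpace F]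
    (p : ∀ i, F →L[ℝ] E i) (q : ∀ i, E i →L[ℝ] F) {B : Set F} (hB : Bornology.IsVonNBounded ℝ B)
    {M : TopologicalSpace.Compacts (WeakDual ℝ F)} (hM : M ∈ eqc F) (J : Finset ι)
    (hJ : ∀ x ∈ B, ∀ φ ∈ M, φ x = ∑ i ∈ J, φ (q i (p i x))) : S M (restriction M '' B) := by
  refine hS.mono _ _ _ ?_ (hS.finsetSum J (fun i => restriction M '' (q i '' (p i '' B)))
    fun i _ => (hE i).image hS (q i) (hB.image (p i)) hM)
  rintro _ ⟨x, hx, rfl⟩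
  refine ⟨fun i => restriction M (q i (p i x)), fun i _ =>
    Set.mem_image_of_mem _ (Set.mem_image_of_mem _ (Set.mem_image_of_mem _ hx)), ?_⟩
  ext φ
  rw [ContinuousMap.sum_apply]
  exact hJ x hx φ φ.2

/-- An equicontinuous set of functionals on a product only involves finitely many coordinates. -/
theorem exists_finset_forall_eq_zero_of_mem_eqc {ι : Type*} {E : ι → Type*}
    [∀ i, AddCommGroup (E i)] [∀ i, Module ℝ (E i)] [∀ i, TopologicalSpace (E i)]
    {M : TopologicalSpace.Compacts (WeakDual ℝ (∀ i, E i))} (hM : M ∈ eqc (∀ i, E i)) :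
    ∃ J : Finset ι, ∀ x : ∀ i, E i, (∀ i ∈ J, x i = 0) → ∀ φ ∈ M, φ x = 0 := by
  obtain ⟨U, hU, hUM⟩ := exists_nhds_forall_abs_lt_one hM
  rw [nhds_pi, Filter.mem_pi] at hU
  obtain ⟨J, hJ, V, hV, hVU⟩ := hU
  refine ⟨hJ.toFinset, fun x hx φ hφ => ?_⟩
  -- all multiples of `x` lie in `U`
  have hlt : ∀ c : ℝ, |c * φ x| < 1 := fun c => by
    rw [← smul_eq_mul, ← map_smul]
    refine hUM _ (hVU fun i hi => ?_) φ hφ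
    have : (c • x) i = 0 := by simp [hx i (hJ.mem_toFinset.2 hi)]
    rw [this]
    exact mem_of_mem_nhds (hV i)
  by_contra h
  have := hlt (φ x)⁻¹
  rw [inv_mul_cancel₀ h, abs_one] at this
  exact lt_irrefl _ this

theorem IsSmallFor.pi (hS : IsAdmissibleClass S) {ι : Type u} {E : ι → Type u}
    [∀ i, AddCommGroup (E i)] [∀ i, Module ℝ (E i)] [∀ i, TopologicalSpace (E i)]
    (hE : ∀ i, IsSmallFor S (E i)) : IsSmallFor S (∀ i, E i) := by
  classical
  intro B hB M hM
  obtain ⟨J, hJ⟩ := exists_finset_forall_eq_zero_of_mem_eqc hM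
  refine IsSmallFor.of_sum hS hE (ContinuousLinearMap.proj (R := ℝ) (φ := E))
    (ContinuousLinearMap.single ℝ E) hB hM J fun x _ φ hφ => ?_
  rw [← map_sum, ← sub_eq_zero, ← map_sub]
  refine hJ _ (fun i hi => ?_) φ hφ
  simp [Finset.sum_apply, hi]

theorem IsSmallFor.of_isLarge (hS : IsAdmissibleClass S) {E : Type u} [AddCommGroup E] [Module ℝ E]
    [TopologicalSpace E] {G : Submodule ℝ E} (hG : IsLarge G) (h : IsSmallFor S G) :
    IsSmallFor S E := by
  intro B hB M hM
  obtain ⟨C, hC, hBC⟩ := hG B hB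
  refine hS.mono _ _ _ ?_ (hS.closure _ _ (h.image hS G.subtypeL hC hM))
  exact (Set.image_mono hBC).trans (image_closure_subset_closure_image (continuous_restriction hM))

theorem IsSmallFor.completion (hS : IsAdmissibleClass S) {V : Type u} [NormedAddCommGroup V]
    [NormedSpace ℝ V] (hV : IsSmallFor S V) : IsSmallFor S (UniformSpace.Completion V) := by
  let T : V →L[ℝ] UniformSpace.Completion V := UniformSpace.Completion.toComplL
  intro B hB M hM
  obtain ⟨r, hr⟩ := ((NormedSpace.isVonNBounded_iff ℝ).1 hB).subset_ball 0
  refine hS.mono _ _ _ ?_ (hS.closure _ _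
    (hV.image hS T (NormedSpace.isVonNBounded_ball ℝ V r) hM))
  refine (Set.image_mono ?_).trans
    (image_closure_subset_closure_image (continuous_restriction hM))
  refine (hr.trans (UniformSpace.Completion.denseRange_coe.open_subset_closure_inter
    Metric.isOpen_ball)).trans (closure_mono ?_)
  rintro _ ⟨hx, v, rfl⟩
  exact ⟨v, by simpa using hx, rfl⟩

end Stability


/-! ### Locally convex direct sums -/

namespace LCDirectSum

variable {ι : Type*} (E : ι → Type*) [∀ i, AddCommGroup (E i)] [∀ i, Module ℝ (E i)]

theorem proj_incl_self (i : ι) (x : E i) : proj E i (incl E i x) = x := by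
  classical
  exact DirectSum.component.lof_self ℝ i x

theorem proj_incl_of_ne {i j : ι} (h : j ≠ i) (x : E j) : proj E i (incl E j x) = 0 := by
  classical
  exact (DirectSum.component.of ℝ i j x).trans (dif_neg h)

theorem finite_setOf_proj_ne_zero (x : LCDirectSum E) : {i | proj E i x ≠ 0}.Finite :=
  DFinsupp.finite_support x

theorem ext_proj {x y : LCDirectSum E} (h : ∀ i, proj E i x = proj E i y) : x = y :=
  DFinsupp.ext h

theorem eq_sum_incl_proj {J : Finset ι} {x : LCDirectSum E} (h : ∀ i, i ∉ J → proj E i x = 0) :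
    x = ∑ i ∈ J, incl E i (proj E i x) := by
  classical
  refine ext_proj E fun j => ?_
  rw [map_sum]
  by_cases hj : j ∈ J
  · rw [Finset.sum_eq_single_of_mem j hj fun i _ hij => proj_incl_of_ne E hij _, proj_incl_self]
  · rw [h j hj, Finset.sum_eq_zero fun i hi =>
      proj_incl_of_ne E (fun hij : i = j => hj (hij ▸ hi)) _]

variable [∀ i, TopologicalSpace (E i)]

theorem continuous_incl (i : ι) : Continuous (incl E i) :=
  (isLeast_admissible E).1.2.2.2 i

variable {E} in
/-- The universal property of the locally convex direct sum. -/
theorem continuous_of_continuous_comp_incl {W : Type*} [AddCommGroup W] [Module ℝ W]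
    [TopologicalSpace W] [IsTopologicalAddGroup W] [ContinuousSMul ℝ W] [LocallyConvexSpace ℝ W]
    (T : LCDirectSum E →ₗ[ℝ] W) (hT : ∀ i, Continuous (T ∘ incl E i)) : Continuous T :=
  continuous_iff_le_induced.2 <| sInf_le ⟨topologicalAddGroup_induced T, continuousSMul_induced T,
    LocallyConvexSpace.induced T, fun i => continuous_induced_rng.2 (hT i)⟩

/-- A bounded subset of a locally convex direct sum lives in finitely many summands: otherwise there
is a continuous linear map to `ℓ^∞`, given by scaled functionals on distinct summands, which is
unbounded on it. -/
theorem finite_setOf_exists_proj_ne_zero [∀ i, IsTopologicalAddGroup (E i)]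
    [∀ i, ContinuousSMul ℝ (E i)] [∀ i, LocallyConvexSpace ℝ (E i)] [∀ i, T2Space (E i)]
    {B : Set (LCDirectSum E)} (hB : Bornology.IsVonNBounded ℝ B) :
    {i | ∃ x ∈ B, proj E i x ≠ 0}.Finite := by
  classical
  by_contra hinf
  let e : ℕ ↪ _ := Set.Infinite.natEmbedding _ hinf
  let i : ℕ → ι := fun n => e n
  have hi : Function.Injective i := Subtype.val_injective.comp e.injective
  choose x hxB hx using fun n => (e n).2
  choose ψ hψ using fun n => SeparatingDual.exists_ne_zero (R := ℝ) (hx n)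
  let c : ℕ → ℝ := fun n => n * (ψ n (proj E (i n) (x n)))⁻¹
  -- the coordinates of `T` are scaled so that the `n`-th one takes the value `n` on `x n`
  let Ψ : ∀ n, LCDirectSum E →ₗ[ℝ] ℝ := fun n => c n • ((ψ n).toLinearMap ∘ₗ proj E (i n))
  have hΨ : ∀ n y, Ψ n y = c n * ψ n (proj E (i n) y) := fun n y => rfl
  have hmem : ∀ y, Memℓp (fun n => Ψ n y) ⊤ := fun y => by
    refine (memℓp_zero ?_).of_exponent_ge zero_le
    refine ((finite_setOf_proj_ne_zero E y).preimage hi.injOn).subset fun n hn h => hn ?_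
    rw [hΨ, h, map_zero, mul_zero]
  let T : LCDirectSum E →ₗ[ℝ] lp (fun _ : ℕ => ℝ) ⊤ :=
    { toFun := fun y => ⟨fun n => Ψ n y, hmem y⟩
      map_add' := fun y z => Subtype.ext (funext fun n => map_add (Ψ n) y z)
      map_smul' := fun a y => Subtype.ext (funext fun n => map_smul (Ψ n) a y) }
  have hTapp : ∀ y n, T y n = Ψ n y := fun y n => rfl
  have hT : Continuous T := by
    refine continuous_of_continuous_comp_incl T fun j => ?_
    by_cases hj : ∃ n, i n = j
    · obtain ⟨n, rfl⟩ := hj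
      have : T ∘ incl E (i n) = fun y =>
          lp.singleContinuousLinearMap ℝ (fun _ : ℕ => ℝ) ⊤ n (c n * ψ n y) := by
        funext y
        ext m
        rw [Function.comp_apply, hTapp, hΨ]
        by_cases hmn : m = n
        · subst hmn
          simp [proj_incl_self]
        · rw [proj_incl_of_ne E (hi.ne (Ne.symm hmn))]
          simp [hmn]
      rw [this]
      fun_prop
    · have : T ∘ incl E j = fun _ => 0 := by
        funext y
        ext m
        rw [Function.comp_apply, hTapp, hΨ, proj_incl_of_ne E fun h => hj ⟨m, h.symm⟩]
        simp
      rw [this]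
      exact continuous_const
  obtain ⟨r, hr⟩ := ((NormedSpace.isVonNBounded_iff ℝ).1
    (hB.image (⟨T, hT⟩ : LCDirectSum E →L[ℝ] _))).exists_norm_le
  obtain ⟨n, hn⟩ := exists_nat_gt r
  have h1 : ‖T (x n)‖ ≤ r := hr _ ⟨x n, hxB n, rfl⟩
  have h2 : ‖T (x n) n‖ ≤ ‖T (x n)‖ := lp.norm_apply_le_norm ENNReal.top_ne_zero _ n
  rw [hTapp, hΨ, mul_assoc, inv_mul_cancel₀ (hψ n), mul_one, Real.norm_natCast] at h2
  exact absurd (h2.trans h1) (not_le.2 hn)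

end LCDirectSum

section Stability

variable {S : ∀ (K : Type u) [TopologicalSpace K] [CompactSpace K] [T2Space K],
  Set C(K, ℝ) → Prop}

theorem IsSmallFor.lcDirectSum (hS : IsAdmissibleClass S) {ι : Type u} {E : ι → Type u}
    [∀ i, AddCommGroup (E i)] [∀ i, Module ℝ (E i)] [∀ i, TopologicalSpace (E i)]
    [∀ i, IsTopologicalAddGroup (E i)] [∀ i, ContinuousSMul ℝ (E i)]
    [∀ i, LocallyConvexSpace ℝ (E i)] [∀ i, T2Space (E i)] (hE : ∀ i, IsSmallFor S (E i)) :
    IsSmallFor S (LCDirectSum E) := by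
  intro B hB M hM
  have hfin := LCDirectSum.finite_setOf_exists_proj_ne_zero E hB
  refine IsSmallFor.of_sum hS hE
    (fun i => (⟨LCDirectSum.proj E i, LCDirectSum.continuous_proj E i⟩ : LCDirectSum E →L[ℝ] E i))
    (fun i => (⟨LCDirectSum.incl E i, LCDirectSum.continuous_incl E i⟩ : E i →L[ℝ] LCDirectSum E))
    hB hM hfin.toFinset fun x hx φ _ => ?_
  rw [← map_sum]
  refine congrArg φ (LCDirectSum.eq_sum_incl_proj E fun i hi => ?_)
  by_contra h
  exact hi (hfin.mem_toFinset.2 ⟨x, hx, h⟩)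

theorem IsAdmissibleClass.isStable (hS : IsAdmissibleClass S) : IsStable.{u} (IsSmallFor S) where
  subspaces := fun _ _ _ _ _ _ _ _ G hE => hE.submodule hS G
  boundCoveringMaps := fun _ _ _ _ _ _ _ _ _ _ _ _ _ _ _ _ T hT hE =>
    hE.of_isBoundCovering hS T hT
  products := fun _ _ _ _ _ _ _ _ _ hE => IsSmallFor.pi hS hE
  directSums := fun _ _ _ _ _ _ _ _ _ hE => IsSmallFor.lcDirectSum hS hE
  inverseLimits := fun _ _ _ _ _ _ _ _ _ _ _ _ hE => (IsSmallFor.pi hS hE).submodule hS _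
  largeDenseSubspaces := fun _ _ _ _ _ _ _ _ _ _ hG h => IsSmallFor.of_isLarge hS hG h
  completions := fun _ _ _ hV => hV.completion hS

theorem BornologicalClass.isAdmissibleClass (𝔅 : BornologicalClass.{u}) :
    IsAdmissibleClass.{u} fun K _ _ _ A => @Bornology.IsBounded _ (𝔅.bornology K) A where
  mono K _ _ _ A B hAB hB := @Bornology.IsBounded.subset _ (𝔅.bornology K) _ _ hB hAB
  zero K _ _ _ := @Bornology.isBounded_singleton _ (𝔅.bornology K) 0
  add K _ _ _ := @IsSeparatedConvexVectorBornology.add _ _ _ (𝔅.bornology K)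
    (𝔅.isSeparatedConvexVectorBornology K)
  comp := 𝔅.comp
  of_comp := 𝔅.of_comp
  closure K _ _ _ A hA := by
    refine @Bornology.IsBounded.subset _ (𝔅.bornology K) _ _ (𝔅.bipolar K A hA) fun f hf φ hφ => ?_
    have hcl : IsClosed {g | |φ g| ≤ 1} := isClosed_le (by fun_prop) continuous_const
    exact closure_minimal hφ hcl hf

theorem BornologicalClass.isStable_isSmall (𝔅 : BornologicalClass.{u}) :
    IsStable.{u} 𝔅.IsSmall := by
  convert 𝔅.isAdmissibleClass.isStable using 1
  funext E _ _ _
  exact propext ⟨fun h B hB => (h B hB).2, fun h B hB => ⟨hB, h B hB⟩⟩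

end Stability


/-! ### Admissible classes defined by properties of families of functions -/

/-- The properties of a class `Q` of families of real functions which ensure that the norm bounded
families of continuous functions in `Q` form an admissible class. -/
structure IsAdmissibleFamilyClass (Q : ∀ (X : Type u) [TopologicalSpace X], Set (X → ℝ) → Prop) :
    Prop where
  mono : ∀ (X : Type u) [TopologicalSpace X] (F G : Set (X → ℝ)), F ⊆ G → Q X G → Q X F
  zero : ∀ (X : Type u) [TopologicalSpace X], Q X {0}
  add : ∀ (X : Type u) [TopologicalSpace X] [CompactSpace X] (F G : Set (X → ℝ)),
    (∀ f ∈ F, Continuous f) → (∀ g ∈ G, Continuous g) → IsBoundedFamily F → IsBoundedFamily G →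
    Q X F → Q X G → Q X (Set.image2 (· + ·) F G)
  comp : ∀ (X Y : Type u) [TopologicalSpace X] [TopologicalSpace Y] (φ : X → Y), Continuous φ →
    ∀ F : Set (Y → ℝ), Q Y F → Q X ((fun f => f ∘ φ) '' F)
  of_comp : ∀ (X Y : Type u) [TopologicalSpace X] [TopologicalSpace Y] [CompactSpace X]
    [CompactSpace Y] [T2Space Y] (φ : X → Y), Continuous φ → Function.Surjective φ →
    ∀ F : Set (Y → ℝ), Q X ((fun f => f ∘ φ) '' F) → Q Y F
  approx : ∀ (X : Type u) [TopologicalSpace X] (F G : Set (X → ℝ)), IsBoundedFamily F →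
    (∀ ε > 0, ∀ g ∈ G, ∃ f ∈ F, ∀ x, |g x - f x| < ε) → Q X F → Q X G

theorem IsAdmissibleFamilyClass.isAdmissibleClass
    {Q : ∀ (X : Type u) [TopologicalSpace X], Set (X → ℝ) → Prop}
    (hQ : IsAdmissibleFamilyClass Q) :
    IsAdmissibleClass.{u} fun K _ _ _ A =>
      IsBoundedFamily ((fun f : C(K, ℝ) => (f : K → ℝ)) '' A) ∧
        Q K ((fun f : C(K, ℝ) => (f : K → ℝ)) '' A) where
  mono K _ _ _ A B hAB hB :=
    ⟨hB.1.imp fun C hC f hf => hC f (Set.image_mono hAB hf), hQ.mono _ _ _ (Set.image_mono hAB) hB.2⟩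
  zero K _ _ _ := by
    rw [Set.image_singleton]
    refine ⟨⟨0, ?_⟩, hQ.zero K⟩
    rintro _ rfl x
    simp
  add K _ _ _ A B hA hB := by
    rw [Set.image_image2]
    have h := hQ.add K _ _ (by rintro _ ⟨f, -, rfl⟩; exact f.continuous)
      (by rintro _ ⟨f, -, rfl⟩; exact f.continuous) hA.1 hB.1 hA.2 hB.2
    rw [Set.image2_image_left, Set.image2_image_right] at h
    refine ⟨?_, h⟩
    obtain ⟨⟨C, hC⟩, D, hD⟩ := hA.1, hB.1
    refine ⟨C + D, ?_⟩
    rintro _ ⟨f, hf, g, hg, rfl⟩ x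
    exact (abs_add_le _ _).trans
      (add_le_add (hC _ (Set.mem_image_of_mem _ hf) x) (hD _ (Set.mem_image_of_mem _ hg) x))
  comp K₁ K₂ _ _ _ _ _ _ φ A hA := by
    have h := hQ.comp _ _ φ φ.continuous _ hA.2
    rw [Set.image_image] at h ⊢
    refine ⟨hA.1.imp fun C hC => ?_, h⟩
    rintro _ ⟨f, hf, rfl⟩ x
    exact hC _ (Set.mem_image_of_mem _ hf) (φ x)
  of_comp K₁ K₂ _ _ _ _ _ _ φ hφ A hA := by
    rw [Set.image_image] at hA
    refine ⟨hA.1.imp fun C hC => ?_, hQ.of_comp _ _ φ φ.continuous hφ _ ?_⟩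
    · rintro _ ⟨f, hf, rfl⟩ x
      obtain ⟨y, rfl⟩ := hφ x
      exact hC _ (Set.mem_image_of_mem _ hf) y
    · rw [Set.image_image]
      exact hA.2
  closure K _ _ _ A hA := by
    have hclose : ∀ ε > 0, ∀ g ∈ (fun f : C(K, ℝ) => (f : K → ℝ)) '' closure A,
        ∃ f ∈ (fun f : C(K, ℝ) => (f : K → ℝ)) '' A, ∀ x, |g x - f x| < ε := by
      rintro ε hε _ ⟨g, hg, rfl⟩
      obtain ⟨f, hf, hgf⟩ := Metric.mem_closure_iff.1 hg ε hε
      exact ⟨f, Set.mem_image_of_mem _ hf, (ContinuousMap.dist_lt_iff hε).1 hgf⟩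
    refine ⟨?_, hQ.approx K _ _ hA.1 hclose hA.2⟩
    obtain ⟨C, hC⟩ := hA.1
    refine ⟨C + 1, fun g hg x => ?_⟩
    obtain ⟨f, hf, hgf⟩ := hclose 1 one_pos g hg
    have h1 := abs_lt.1 (hgf x)
    have h2 := abs_le.1 (hC f hf x)
    exact abs_le.2 ⟨by linarith, by linarith⟩

theorem isBoundedFamily_familyOn {E : Type*} [AddCommGroup E] [Module ℝ E] [TopologicalSpace E]
    {M : TopologicalSpace.Compacts (WeakDual ℝ E)} (hM : M ∈ eqc E) {B : Set E}
    (hB : Bornology.IsVonNBounded ℝ B) : IsBoundedFamily (familyOn M B) := by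
  obtain ⟨C, hC⟩ := exists_abs_le_of_isVonNBounded hM hB
  refine ⟨C, ?_⟩
  rintro _ ⟨x, hx, rfl⟩ φ
  exact hC x hx φ φ.2

theorem IsAdmissibleFamilyClass.isStable
    {Q : ∀ (X : Type u) [TopologicalSpace X], Set (X → ℝ) → Prop}
    (hQ : IsAdmissibleFamilyClass Q) :
    IsStable.{u} fun E _ _ _ => ∀ B : Set E, Bornology.IsVonNBounded ℝ B →
      Bornology.IsVonNBounded ℝ B ∧ ∀ M ∈ eqc E, Q M (familyOn M B) := by
  convert hQ.isAdmissibleClass.isStable using 1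
  funext E _ _ _
  have hfam : ∀ (M : TopologicalSpace.Compacts (WeakDual ℝ E)) (B : Set E),
      (fun f : C(M, ℝ) => (f : M → ℝ)) '' (restriction M '' B) = familyOn M B :=
    fun M B => Set.image_image _ _ _
  simp only [IsSmallFor, hfam]
  exact propext ⟨fun h B hB M hM => ⟨isBoundedFamily_familyOn hM hB, (h B hB).2 M hM⟩,
    fun h B hB => ⟨hB, fun M hM => (h B hB M hM).2⟩⟩

/-! ### Fragmented families -/

theorem isFragmentedFamily_iff {X : Type*} [TopologicalSpace X] {F : Set (X → ℝ)} :
    IsFragmentedFamily F ↔ ∀ A : Set X, A.Nonempty → ∀ ε > 0, ∃ O : Set X, IsOpen O ∧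
      (O ∩ A).Nonempty ∧ ∀ f ∈ F, ∀ x ∈ O ∩ A, ∀ y ∈ O ∩ A, |f x - f y| < ε := by
  refine ⟨fun h A hA ε hε => h A hA _ (Metric.dist_mem_uniformity hε), fun h A hA V hV => ?_⟩
  obtain ⟨ε, hε, hV⟩ := Metric.mem_uniformity_dist.1 hV
  obtain ⟨O, hO, hne, hs⟩ := h A hA ε hε
  exact ⟨O, hO, hne, fun f hf x hx y hy => hV (hs f hf x hx y hy)⟩

/-- Fragmentability descends along surjections of compact spaces: by Zorn's lemma there is a minimal
closed set mapping onto a given closed set, and the image of a nonempty relatively open subset of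
it has nonempty relative interior. -/
theorem IsFragmentedFamily.of_comp {X Y : Type u} [TopologicalSpace X] [TopologicalSpace Y]
    [CompactSpace X] [CompactSpace Y] [T2Space Y] {φ : X → Y} (hφ : Continuous φ)
    (hsurj : Function.Surjective φ) {F : Set (Y → ℝ)}
    (hF : IsFragmentedFamily ((fun f => f ∘ φ) '' F)) : IsFragmentedFamily F := by
  intro A hA V hV
  have hDc : IsClosed (φ ⁻¹' closure A) := isClosed_closure.preimage hφ
  have : CompactSpace (φ ⁻¹' closure A) := isCompact_iff_compactSpace.1 hDc.isCompact
  let ρ : φ ⁻¹' closure A → closure A := (closure A).restrictPreimage φ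
  have hρ : Continuous ρ := hφ.restrictPreimage
  obtain ⟨Z, hZ, hZsurj, hZmin⟩ := exists_compact_surjective_zorn_subset hρ
    (Set.restrictPreimage_surjective _ hsurj)
  have hZne : Z.Nonempty := by
    obtain ⟨a, ha⟩ := hA
    obtain ⟨z, hz, -⟩ := hZsurj.ge (Set.mem_univ (⟨a, subset_closure ha⟩ : closure A))
    exact ⟨z, hz⟩
  obtain ⟨O, hO, ⟨_, hzO, z, hz, rfl⟩, hs⟩ := hF _ (hZne.image Subtype.val) V hV
  let N : Set Z := {e | (e : X) ∉ O}
  have hNc : IsClosed N := (hO.preimage (by fun_prop : Continuous fun e : Z => (e : X))).isClosed_compl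
  have hN : N ≠ Set.univ := fun h => (h.ge (Set.mem_univ ⟨z, hz⟩) : (z : X) ∉ O) hzO
  have himg : IsClosed (Z.domRestrict ρ '' N) :=
    (hNc.isCompact.image hρ.continuousOn.domRestrict).isClosed
  obtain ⟨W, hW, hWN⟩ := isOpen_induced_iff.1 himg.isOpen_compl
  have hWmem : ∀ y (hy : y ∈ closure A), y ∈ W ↔ (⟨y, hy⟩ : closure A) ∉ Z.domRestrict ρ '' N :=
    fun y hy => Set.ext_iff.1 hWN ⟨y, hy⟩
  -- the part of `A` inside `W` is covered by the image of the part of `Z` inside `O`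
  have hlift : ∀ y ∈ W ∩ A, ∃ x ∈ O ∩ Subtype.val '' Z, φ x = y := by
    rintro y ⟨hyW, hyA⟩
    obtain ⟨x, hx, hxy⟩ := hZsurj.ge (Set.mem_univ (⟨y, subset_closure hyA⟩ : closure A))
    refine ⟨x, ⟨?_, Set.mem_image_of_mem _ hx⟩, congrArg Subtype.val hxy⟩
    by_contra hxO
    exact (hWmem y (subset_closure hyA)).1 hyW ⟨⟨x, hx⟩, hxO, hxy⟩
  refine ⟨W, hW, ?_, fun f hf y hy y' hy' => ?_⟩
  · obtain ⟨⟨y, hy⟩, hyN⟩ := (Set.ne_univ_iff_exists_notMem _).1 (hZmin N hN hNc)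
    exact mem_closure_iff.1 hy W hW ((hWmem y hy).2 hyN)
  · obtain ⟨x, hx, rfl⟩ := hlift y hy
    obtain ⟨x', hx', rfl⟩ := hlift y' hy'
    exact hs _ (Set.mem_image_of_mem _ hf) x hx x' hx'

theorem isAdmissibleFamilyClass_isFragmentedFamily :
    IsAdmissibleFamilyClass.{u} fun _ _ F => IsFragmentedFamily F where
  mono X _ F G hFG hG A hA V hV :=
    (hG A hA V hV).imp fun O hO => ⟨hO.1, hO.2.1, fun f hf => hO.2.2 f (hFG hf)⟩
  zero X _ A hA V hV := by
    refine ⟨Set.univ, isOpen_univ, by simpa using hA, ?_⟩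
    rintro _ rfl x - y -
    exact refl_mem_uniformity hV
  add X _ _ F G _ _ _ _ hF hG := by
    rw [isFragmentedFamily_iff] at hF hG ⊢
    intro A hA ε hε
    obtain ⟨O, hO, hne, hs⟩ := hF A hA (ε / 2) (half_pos hε)
    obtain ⟨O', hO', hne', hs'⟩ := hG (O ∩ A) hne (ε / 2) (half_pos hε)
    refine ⟨O' ∩ O, hO'.inter hO, by rwa [Set.inter_assoc], ?_⟩
    rintro _ ⟨f, hf, g, hg, rfl⟩ x ⟨⟨hx', hx⟩, hxA⟩ y ⟨⟨hy', hy⟩, hyA⟩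
    have h1 := abs_lt.1 (hs f hf x ⟨hx, hxA⟩ y ⟨hy, hyA⟩)
    have h2 := abs_lt.1 (hs' g hg x ⟨hx', hx, hxA⟩ y ⟨hy', hy, hyA⟩)
    simp only [Pi.add_apply]
    exact abs_lt.2 ⟨by linarith, by linarith⟩
  comp X Y _ _ φ hφ F hF A hA V hV := by
    obtain ⟨O, hO, ⟨_, hxO, x, hxA, rfl⟩, hs⟩ := hF (φ '' A) (hA.image φ) V hV
    refine ⟨φ ⁻¹' O, hO.preimage hφ, ⟨x, hxO, hxA⟩, ?_⟩
    rintro _ ⟨f, hf, rfl⟩ y ⟨hyO, hyA⟩ z ⟨hzO, hzA⟩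
    exact hs f hf _ ⟨hyO, Set.mem_image_of_mem _ hyA⟩ _ ⟨hzO, Set.mem_image_of_mem _ hzA⟩
  of_comp X Y _ _ _ _ _ φ hφ hsurj F hF := hF.of_comp hφ hsurj
  approx X _ F G _ hFG hF := by
    rw [isFragmentedFamily_iff] at hF ⊢
    intro A hA ε hε
    obtain ⟨O, hO, hne, hs⟩ := hF A hA (ε / 3) (by linarith)
    refine ⟨O, hO, hne, fun g hg x hx y hy => ?_⟩
    obtain ⟨f, hf, hgf⟩ := hFG (ε / 3) (by linarith) g hg
    have h1 := abs_lt.1 (hs f hf x hx y hy)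
    have h2 := abs_lt.1 (hgf x)
    have h3 := abs_lt.1 (hgf y)
    exact abs_lt.2 ⟨by linarith, by linarith⟩

/-! ### The double limit property -/

theorem exists_subseq_tendsto_of_forall_abs_le {X : Type*} [Countable X] {C : ℝ} (a : ℕ → X → ℝ)
    (ha : ∀ n x, |a n x| ≤ C) :
    ∃ (φ : ℕ → ℕ) (g : X → ℝ), StrictMono φ ∧ (∀ x, |g x| ≤ C) ∧
      ∀ x, Tendsto (fun n => a (φ n) x) atTop (𝓝 (g x)) := by
  obtain ⟨g, hg, φ, hφ, h⟩ := (isCompact_univ_pi fun _ : X =>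
    isCompact_Icc (a := -C) (b := C)).tendsto_subseq (x := a) fun n x _ => abs_le.1 (ha n x)
  exact ⟨φ, g, hφ, fun x => abs_le.2 (hg x trivial), tendsto_pi_nhds.1 h⟩

/-- A bounded double sequence has a double subsequence for which both iterated limits exist. -/
theorem exists_subseq_iterated_limits {C : ℝ} (a : ℕ → ℕ → ℝ) (ha : ∀ n m, |a n m| ≤ C) :
    ∃ (φ ψ : ℕ → ℕ) (g h : ℕ → ℝ) (α β : ℝ), StrictMono φ ∧ StrictMono ψ ∧
      (∀ n, Tendsto (fun m => a (φ n) (ψ m)) atTop (𝓝 (g n))) ∧ Tendsto g atTop (𝓝 α) ∧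
      (∀ m, Tendsto (fun n => a (φ n) (ψ m)) atTop (𝓝 (h m))) ∧ Tendsto h atTop (𝓝 β) := by
  obtain ⟨ψ, g, hψ, hgC, hg⟩ :=
    exists_subseq_tendsto_of_forall_abs_le (fun m n => a n m) fun m n => ha n m
  obtain ⟨φ, h, hφ, hhC, hh⟩ := exists_subseq_tendsto_of_forall_abs_le
    (fun n (o : Option ℕ) => o.elim (g n) fun m => a n (ψ m)) (C := C)
    (by rintro n (_ | m); exacts [hgC n, ha _ _])
  obtain ⟨θ, β, hθ, -, hβ⟩ := exists_subseq_tendsto_of_forall_abs_le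
    (fun m (_ : Unit) => h (some m)) fun m _ => hhC (some m)
  exact ⟨φ, ψ ∘ θ, g ∘ φ, fun m => h (some (θ m)), h none, β (), hφ, hψ.comp hθ,
    fun n => (hg (φ n)).comp hθ.tendsto_atTop, hh none, fun m => hh (some (θ m)), hβ ()⟩

theorem isAdmissibleFamilyClass_hasDLP : IsAdmissibleFamilyClass.{u} fun _ _ F => HasDLP F where
  mono X _ F G hFG hG f hf := hG f fun n => hFG (hf n)
  zero X _ f hf x g h a b hg ha hh hb := by
    have hf0 : ∀ n y, f n y = 0 := fun n y => congrFun (hf n : f n = 0) y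
    simp only [hf0] at hg hh
    have hg0 : g = 0 := funext fun n => tendsto_nhds_unique (hg n) tendsto_const_nhds
    have hh0 : h = 0 := funext fun n => tendsto_nhds_unique (hh n) tendsto_const_nhds
    subst hg0 hh0
    exact tendsto_nhds_unique ha hb
  add X _ _ F G _ _ hFb _ hF hG := by
    intro f hf x g h a b hg ha hh hb
    choose u hu v hv huv using hf
    have hfuv : ∀ n y, v n y = f n y - u n y := fun n y => by
      rw [← huv n]
      simp
    obtain ⟨C, hC⟩ := hFb
    obtain ⟨φ, ψ, g', h', α, β, hφ, hψ, hg', hα, hh', hβ⟩ :=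
      exists_subseq_iterated_limits (fun n m => u n (x m)) fun n m => hC _ (hu n) _
    have h1 : α = β := hF (u ∘ φ) (fun n => hu _) (x ∘ ψ) g' h' α β hg' hα hh' hβ
    have h2 : a - α = b - β := by
      refine hG (v ∘ φ) (fun n => hv _) (x ∘ ψ) (fun n => g (φ n) - g' n)
        (fun m => h (ψ m) - h' m) _ _ (fun n => ?_) ((ha.comp hφ.tendsto_atTop).sub hα)
        (fun m => ?_) ((hb.comp hψ.tendsto_atTop).sub hβ)
      · simp only [Function.comp_apply, hfuv]
        exact ((hg (φ n)).comp hψ.tendsto_atTop).sub (hg' n)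
      · simp only [Function.comp_apply, hfuv]
        exact ((hh (ψ m)).comp hφ.tendsto_atTop).sub (hh' m)
    linarith
  comp X Y _ _ φ _ F hF f hf x := by
    choose u hu huf using hf
    obtain rfl : (fun n => u n ∘ φ) = f := funext huf
    exact hF u hu (φ ∘ x)
  of_comp X Y _ _ _ _ _ φ _ hsurj F hF f hf x := by
    choose y hy using fun m => hsurj (x m)
    obtain rfl : φ ∘ y = x := funext hy
    exact hF (fun n => f n ∘ φ) (fun n => Set.mem_image_of_mem _ (hf n)) y
  approx X _ F G hFb hFG hF := by
    intro f hf x g h a b hg ha hh hb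
    refine eq_of_abs_sub_le_all fun ε hε => ?_
    choose u hu hfu using fun n => hFG (ε / 2) (half_pos hε) (f n) (hf n)
    obtain ⟨C, hC⟩ := hFb
    obtain ⟨φ, ψ, g', h', α, β, hφ, hψ, hg', hα, hh', hβ⟩ :=
      exists_subseq_iterated_limits (fun n m => u n (x m)) fun n m => hC _ (hu n) _
    have h1 : α = β := hF (u ∘ φ) (fun n => hu _) (x ∘ ψ) g' h' α β hg' hα hh' hβ
    have h2 : |a - α| ≤ ε / 2 :=
      le_of_tendsto ((ha.comp hφ.tendsto_atTop).sub hα).abs <| Eventually.of_forall fun n =>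
        le_of_tendsto (((hg (φ n)).comp hψ.tendsto_atTop).sub (hg' n)).abs <|
          Eventually.of_forall fun m => (hfu _ _).le
    have h3 : |b - β| ≤ ε / 2 :=
      le_of_tendsto ((hb.comp hψ.tendsto_atTop).sub hβ).abs <| Eventually.of_forall fun m =>
        le_of_tendsto (((hh (ψ m)).comp hφ.tendsto_atTop).sub (hh' m)).abs <|
          Eventually.of_forall fun n => (hfu _ _).le
    rw [abs_le] at h2 h3 ⊢
    constructor <;> linarith


/-! ### Independent sequences and Rosenthal's dichotomy -/

/-- A diagonal intersection: given members of a free ultrafilter on `ℕ` indexed by the finite sets,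
there is a sequence each of whose terms lies in all the members indexed by sets of earlier terms. -/
theorem exists_strictMono_forall_mem {R : Finset ℕ → Set ℕ} (hR : ∀ s, R s ∈ hyperfilter ℕ) :
    ∃ L : ℕ → ℕ, StrictMono L ∧ ∀ k, ∀ s : Finset ℕ, (∀ m ∈ s, ∃ j < k, L j = m) → L k ∈ R s := by
  have hstep : ∀ N : ℕ, ∃ n, N < n ∧ ∀ s ∈ (Finset.range (N + 1)).powerset, n ∈ R s := fun N =>
    (((eventually_gt_atTop N).filter_mono Nat.hyperfilter_le_atTop).and
      ((Finset.eventually_all _).2 fun s _ => hR s)).exists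
  choose next hlt hnext using hstep
  let L : ℕ → ℕ := fun k => next^[k + 1] 0
  have hL : ∀ k, L (k + 1) = next (L k) := fun k => Function.iterate_succ_apply' next _ _
  have hmono : StrictMono L := strictMono_nat_of_lt_succ fun k => by
    rw [hL]
    exact hlt _
  refine ⟨L, hmono, fun k s hs => ?_⟩
  cases k with
  | zero =>
    refine hnext 0 s (Finset.mem_powerset.2 fun m hm => ?_)
    obtain ⟨j, hj, -⟩ := hs m hm
    exact absurd hj (Nat.not_lt_zero j)
  | succ k =>
    rw [hL]
    refine hnext _ s (Finset.mem_powerset.2 fun m hm => ?_)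
    obtain ⟨j, hj, rfl⟩ := hs m hm
    exact Finset.mem_range_succ_iff.2 (hmono.monotone (Nat.lt_succ_iff.1 hj))

/-- The pairs `(P, Q)` of finite sets from which one is led to an empty intersection
`(⋂ n ∈ P, A n) ∩ ⋂ n ∈ Q, B n`, when at each step one side is chosen, and a number from a set
belonging to the free ultrafilter is added to it. -/
inductive LeadsToEmpty {X : Type*} (A B : ℕ → Set X) : Finset ℕ → Finset ℕ → Prop
  | empty {P Q : Finset ℕ} : (⋂ n ∈ P, A n) ∩ ⋂ n ∈ Q, B n = ∅ → LeadsToEmpty A B P Q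
  | left {P Q : Finset ℕ} (s : Set ℕ) : s ∈ hyperfilter ℕ →
      (∀ n ∈ s, LeadsToEmpty A B (insert n P) Q) → LeadsToEmpty A B P Q
  | right {P Q : Finset ℕ} (s : Set ℕ) : s ∈ hyperfilter ℕ →
      (∀ n ∈ s, LeadsToEmpty A B P (insert n Q)) → LeadsToEmpty A B P Q

theorem eventually_not_leadsToEmpty {X : Type*} {A B : ℕ → Set X} {P Q : Finset ℕ}
    (h : ¬ LeadsToEmpty A B P Q) : ∀ᶠ n in hyperfilter ℕ,
      ¬ LeadsToEmpty A B (insert n P) Q ∧ ¬ LeadsToEmpty A B P (insert n Q) := by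
  have h1 : {n | LeadsToEmpty A B (insert n P) Q} ∉ hyperfilter ℕ := fun hs =>
    h (.left _ hs fun n hn => hn)
  have h2 : {n | LeadsToEmpty A B P (insert n Q)} ∉ hyperfilter ℕ := fun hs =>
    h (.right _ hs fun n hn => hn)
  exact Filter.inter_mem (Ultrafilter.compl_mem_iff_notMem.2 h1)
    (Ultrafilter.compl_mem_iff_notMem.2 h2)

theorem exists_strictMono_independent {X : Type*} {A B : ℕ → Set X}
    (h : ¬ LeadsToEmpty A B ∅ ∅) : ∃ L : ℕ → ℕ, StrictMono L ∧ ∀ P Q : Finset ℕ, Disjoint P Q →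
      ((⋂ n ∈ P, A (L n)) ∩ ⋂ n ∈ Q, B (L n)).Nonempty := by
  classical
  let R : Finset ℕ → Set ℕ := fun s => {n | ∀ P ∈ s.powerset, ∀ Q ∈ s.powerset,
    ¬ LeadsToEmpty A B P Q →
      ¬ LeadsToEmpty A B (insert n P) Q ∧ ¬ LeadsToEmpty A B P (insert n Q)}
  have hR : ∀ s, R s ∈ hyperfilter ℕ := fun s =>
    (Finset.eventually_all _).2 fun P _ => (Finset.eventually_all _).2 fun Q _ => by
      by_cases hPQ : LeadsToEmpty A B P Q
      · exact Eventually.of_forall fun n h => absurd hPQ h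
      · exact (eventually_not_leadsToEmpty hPQ).mono fun n hn _ => hn
  obtain ⟨L, hL, hLR⟩ := exists_strictMono_forall_mem hR
  have key : ∀ N, ∀ P ⊆ Finset.range N, ∀ Q ⊆ Finset.range N, Disjoint P Q →
      ¬ LeadsToEmpty A B (P.image L) (Q.image L) := by
    intro N
    induction N with
    | zero =>
      intro P hP Q hQ _
      rw [Finset.range_zero, Finset.subset_empty] at hP hQ
      subst hP hQ
      simpa using h
    | succ N ih =>
      intro P hP Q hQ hPQ
      have herase : ∀ T ⊆ Finset.range (N + 1), T.erase N ⊆ Finset.range N := by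
        rw [Finset.range_add_one]
        exact fun T hT => Finset.subset_insert_iff.1 hT
      have hsub : ∀ T ⊆ Finset.range N, T.image L ∈ ((Finset.range N).image L).powerset :=
        fun T hT => Finset.mem_powerset.2 (Finset.image_subset_image hT)
      have hmem : L N ∈ R ((Finset.range N).image L) := hLR N _ fun m hm => by
        obtain ⟨j, hj, rfl⟩ := Finset.mem_image.1 hm
        exact ⟨j, Finset.mem_range.1 hj, rfl⟩
      have hstep := hmem _ (hsub _ (herase P hP)) _ (hsub _ (herase Q hQ))
        (ih _ (herase P hP) _ (herase Q hQ)
          (hPQ.mono (Finset.erase_subset _ _) (Finset.erase_subset _ _)))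
      rw [← Finset.image_insert, ← Finset.image_insert] at hstep
      by_cases hNP : N ∈ P
      · rw [Finset.insert_erase hNP, Finset.erase_eq_of_notMem (Finset.disjoint_left.1 hPQ hNP)]
          at hstep
        exact hstep.1
      · by_cases hNQ : N ∈ Q
        · rw [Finset.insert_erase hNQ, Finset.erase_eq_of_notMem hNP] at hstep
          exact hstep.2
        · have := ih _ (herase P hP) _ (herase Q hQ)
            (hPQ.mono (Finset.erase_subset _ _) (Finset.erase_subset _ _))
          rwa [Finset.erase_eq_of_notMem hNP, Finset.erase_eq_of_notMem hNQ] at this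
  refine ⟨L, hL, fun P Q hPQ => Set.nonempty_iff_ne_empty.2 fun hempty => ?_⟩
  obtain ⟨N, hN⟩ := (P ∪ Q).exists_nat_subset_range
  refine key N P (Finset.subset_union_left.trans hN) Q (Finset.subset_union_right.trans hN) hPQ
    (.empty ?_)
  simpa using hempty

/-- Along a sequence compatible with the sets prescribed by `R`, no point of the intersection given
by `P` and `Q` belongs both to infinitely many of the sets `A n` and to infinitely many of the sets
`B n`: such a point would survive in each of the intersections on the way to an empty one. -/
theorem LeadsToEmpty.exists_forall_false {X : Type*} {A B : ℕ → Set X} {P Q : Finset ℕ}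
    (h : LeadsToEmpty A B P Q) : ∃ R : Finset ℕ → Set ℕ, (∀ s, R s ∈ hyperfilter ℕ) ∧
      ∀ L : ℕ → ℕ, StrictMono L →
        (∀ k, ∀ s : Finset ℕ, (∀ m ∈ s, ∃ j < k, L j = m) → L k ∈ R s) →
        ∀ x ∈ (⋂ n ∈ P, A n) ∩ ⋂ n ∈ Q, B n,
          (∃ᶠ n in atTop, x ∈ A (L n)) → (∃ᶠ n in atTop, x ∈ B (L n)) → False := by
  classical
  -- the sets for `s` come from those for the positions reached by adding an element `n` of `s`;
  -- the remaining terms of the sequence then play against the position reached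
  have merge : ∀ (t : Set ℕ) (R : ℕ → Finset ℕ → Set ℕ), t ∈ hyperfilter ℕ →
      (∀ n ∈ t, ∀ s, R n s ∈ hyperfilter ℕ) → ∃ R' : Finset ℕ → Set ℕ,
        (∀ s, R' s ∈ hyperfilter ℕ) ∧ ∀ L : ℕ → ℕ, StrictMono L →
          (∀ k, ∀ s : Finset ℕ, (∀ m ∈ s, ∃ j < k, L j = m) → L k ∈ R' s) → ∀ k, L k ∈ t ∧
          ∀ i, ∀ s : Finset ℕ, (∀ m ∈ s, ∃ j < i, L (k + 1 + j) = m) →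
            L (k + 1 + i) ∈ R (L k) s := by
    intro t R ht hR
    refine ⟨fun s => {m | m ∈ t ∧ ∀ n ∈ s, n ∈ t → m ∈ R n (s.erase n)}, fun s => ?_,
      fun L hL hLR k => ?_⟩
    · refine Filter.inter_mem ht ((Finset.eventually_all _).2 fun n _ => ?_)
      by_cases hn : n ∈ t
      · exact Filter.mem_of_superset (hR n hn (s.erase n)) fun m hm _ => hm
      · exact Eventually.of_forall fun m h => absurd h hn
    · have hkt : L k ∈ t := (hLR k ∅ (by simp)).1
      refine ⟨hkt, fun i s hs => ?_⟩
      have hks : L k ∉ s := fun hmem => by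
        obtain ⟨j, -, hj⟩ := hs _ hmem
        have := hL.injective hj
        omega
      have := (hLR (k + 1 + i) (insert (L k) s) fun m hm => ?_).2 (L k)
        (Finset.mem_insert_self _ _) hkt
      · rwa [Finset.erase_insert hks] at this
      · rcases Finset.mem_insert.1 hm with rfl | hm
        · exact ⟨k, by omega, rfl⟩
        · obtain ⟨j, hj, rfl⟩ := hs m hm
          exact ⟨k + 1 + j, by omega, rfl⟩
  have tail : ∀ {p : ℕ → Prop} (k : ℕ), (∃ᶠ n in atTop, p n) → ∃ᶠ n in atTop, p (k + n) := by
    intro p k hp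
    rw [frequently_atTop] at hp ⊢
    intro a
    obtain ⟨b, hb, hpb⟩ := hp (k + a)
    exact ⟨b - k, by omega, by rwa [Nat.add_sub_cancel' (by omega)]⟩
  induction h with
  | empty h => exact ⟨fun _ => Set.univ, fun _ => Filter.univ_mem,
      fun L _ _ x hx => absurd hx (h ▸ Set.notMem_empty x)⟩
  | left t ht _ ih =>
    choose! R hR hRL using ih
    obtain ⟨R', hR', hmerge⟩ := merge t R ht hR
    refine ⟨R', hR', fun L hL hLR x hx hA hB => ?_⟩
    obtain ⟨k, hk⟩ := hA.exists
    obtain ⟨hkt, hk'⟩ := hmerge L hL hLR k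
    refine hRL (L k) hkt (fun i => L (k + 1 + i)) (fun i j hij => hL (by omega)) hk' x ?_
      (tail (k + 1) hA) (tail (k + 1) hB)
    rw [Finset.set_biInter_insert]
    exact ⟨⟨hk, hx.1⟩, hx.2⟩
  | right t ht _ ih =>
    choose! R hR hRL using ih
    obtain ⟨R', hR', hmerge⟩ := merge t R ht hR
    refine ⟨R', hR', fun L hL hLR x hx hA hB => ?_⟩
    obtain ⟨k, hk⟩ := hB.exists
    obtain ⟨hkt, hk'⟩ := hmerge L hL hLR k
    refine hRL (L k) hkt (fun i => L (k + 1 + i)) (fun i j hij => hL (by omega)) hk' x ?_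
      (tail (k + 1) hA) (tail (k + 1) hB)
    rw [Finset.set_biInter_insert]
    exact ⟨hx.1, hk, hx.2⟩

/-- Rosenthal's dichotomy for sequences of pairs of sets. -/
theorem exists_strictMono_not_frequently_or_independent {X : Type*} (A B : ℕ → Set X) :
    (∃ L : ℕ → ℕ, StrictMono L ∧
      ∀ x, ¬ ((∃ᶠ n in atTop, x ∈ A (L n)) ∧ ∃ᶠ n in atTop, x ∈ B (L n))) ∨
    ∃ L : ℕ → ℕ, StrictMono L ∧ ∀ P Q : Finset ℕ, Disjoint P Q →
      ((⋂ n ∈ P, A (L n)) ∩ ⋂ n ∈ Q, B (L n)).Nonempty := by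
  by_cases h : LeadsToEmpty A B ∅ ∅
  · left
    obtain ⟨R, hR, hRL⟩ := h.exists_forall_false
    obtain ⟨L, hL, hLR⟩ := exists_strictMono_forall_mem hR
    exact ⟨L, hL, fun x hx => hRL L hL hLR x (by simp) hx.1 hx.2⟩
  · exact Or.inr (exists_strictMono_independent h)

/-! ### Tame families -/

/-- Every sequence in a family without independent sequences has a subsequence which, at each point,
crosses each of finitely many given intervals only finitely often. -/
theorem exists_strictMono_forall_not_frequently {X : Type*} {F : Set (X → ℝ)}
    (hF : ¬ ∃ f : ℕ → X → ℝ, (∀ n, f n ∈ F) ∧ IsIndependentSeq f) {f : ℕ → X → ℝ}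
    (hf : ∀ n, f n ∈ F) {ι : Type*} (a b : ι → ℝ) (hab : ∀ i, a i < b i) (J : Finset ι) :
    ∃ L : ℕ → ℕ, StrictMono L ∧ ∀ i ∈ J, ∀ x,
      ¬ ((∃ᶠ n in atTop, f (L n) x < a i) ∧ ∃ᶠ n in atTop, b i < f (L n) x) := by
  classical
  induction J using Finset.induction_on with
  | empty => exact ⟨id, strictMono_id, by simp⟩
  | insert j J _ ih =>
    obtain ⟨L, hL, h⟩ := ih
    rcases exists_strictMono_not_frequently_or_independent
      (fun n => f (L n) ⁻¹' Set.Iio (a j)) (fun n => f (L n) ⁻¹' Set.Ioi (b j)) with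
      ⟨L', hL', h'⟩ | ⟨L', hL', h'⟩
    · refine ⟨L ∘ L', hL.comp hL', fun i hi x hx => ?_⟩
      rcases Finset.mem_insert.1 hi with rfl | hi
      · exact h' x hx
      · exact h i hi x ⟨hL'.tendsto_atTop.frequently hx.1, hL'.tendsto_atTop.frequently hx.2⟩
    · exact absurd ⟨fun n => f (L (L' n)), fun n => hf _, a j, b j, hab j, h'⟩ hF

/-- Every sequence in a bounded family without independent sequences has a subsequence whose
pointwise oscillation is small. -/
theorem exists_strictMono_mapClusterPt_lt {X : Type*} {F : Set (X → ℝ)} (hFb : IsBoundedFamily F)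
    (hF : ¬ ∃ f : ℕ → X → ℝ, (∀ n, f n ∈ F) ∧ IsIndependentSeq f) {f : ℕ → X → ℝ}
    (hf : ∀ n, f n ∈ F) {δ : ℝ} (hδ : 0 < δ) :
    ∃ L : ℕ → ℕ, StrictMono L ∧ ∀ x p q, MapClusterPt p atTop (fun n => f (L n) x) →
      MapClusterPt q atTop (fun n => f (L n) x) → q < p + δ := by
  obtain ⟨C, hC⟩ := hFb
  -- `p` and `q` are separated by an interval of the grid of mesh `δ / 3`
  let η : ℝ := δ / 3
  have hη : 0 < η := by positivity
  obtain ⟨L, hL, h⟩ := exists_strictMono_forall_not_frequently hF hf (fun k : ℤ => k * η)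
    (fun k : ℤ => (k + 1) * η) (fun k => by nlinarith)
    (Finset.Icc (⌊-C / η⌋ + 1) (⌊C / η⌋ + 1))
  refine ⟨L, hL, fun x p q hp hq => ?_⟩
  by_contra! hpq
  have hpC : p ∈ Set.Icc (-C) C := isClosed_Icc.mem_of_mapClusterPt hp
    (Eventually.of_forall fun n => abs_le.1 (hC _ (hf _) x))
  have h1 : p < ((⌊p / η⌋ + 1 : ℤ) : ℝ) * η := by
    push_cast
    exact (div_lt_iff₀ hη).1 (Int.lt_floor_add_one _)
  have h2 : (((⌊p / η⌋ + 1 : ℤ) : ℝ) + 1) * η < q := by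
    have h3 := (le_div_iff₀ hη).1 (Int.floor_le (p / η))
    have h4 : δ = 3 * η := by simp only [η]; ring
    push_cast
    linarith
  refine h (⌊p / η⌋ + 1) (Finset.mem_Icc.2 ⟨?_, ?_⟩) x
    ⟨hp.frequently (Iio_mem_nhds h1), hq.frequently (Ioi_mem_nhds h2)⟩
  · gcongr
    exact hpC.1
  · gcongr
    exact hpC.2

/-- On a compact space, an independent sequence of continuous functions oscillates at some point
along every subsequence. -/
theorem IsIndependentSeq.exists_forall_le_forall_ge {X : Type*} [TopologicalSpace X]
    [CompactSpace X] {f : ℕ → X → ℝ} (hf : ∀ n, Continuous (f n)) {a b : ℝ}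
    (h : ∀ P Q : Finset ℕ, Disjoint P Q →
      ((⋂ n ∈ P, f n ⁻¹' Set.Iio a) ∩ ⋂ n ∈ Q, f n ⁻¹' Set.Ioi b).Nonempty)
    {L : ℕ → ℕ} (hL : Function.Injective L) :
    ∃ x, ∀ k, f (L (2 * k)) x ≤ a ∧ b ≤ f (L (2 * k + 1)) x := by
  classical
  obtain ⟨x, hx⟩ := CompactSpace.iInter_nonempty
    (t := fun k => {x | f (L (2 * k)) x ≤ a ∧ b ≤ f (L (2 * k + 1)) x})
    (fun k => (isClosed_le (hf _) continuous_const).inter (isClosed_le continuous_const (hf _)))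
    fun s => by
      obtain ⟨x, hxP, hxQ⟩ := h (s.image fun k => L (2 * k)) (s.image fun k => L (2 * k + 1)) <| by
        rw [Finset.disjoint_left]
        intro m hm hm'
        obtain ⟨i, -, rfl⟩ := Finset.mem_image.1 hm
        obtain ⟨j, -, hj⟩ := Finset.mem_image.1 hm'
        have := hL hj
        omega
      refine ⟨x, Set.mem_iInter₂.2 fun k hk => ⟨le_of_lt ?_, le_of_lt ?_⟩⟩
      · exact Set.mem_iInter₂.1 hxP _ (Finset.mem_image_of_mem _ hk)
      · exact Set.mem_iInter₂.1 hxQ _ (Finset.mem_image_of_mem _ hk)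
  exact ⟨x, Set.mem_iInter.1 hx⟩

/-- On a compact space, sums from two bounded families of continuous functions without independent
sequences are never independent: at some point an independent sequence of sums has two cluster
values at distance `b - a` along each subsequence, so one of the two sequences of summands has
cluster values at distance at least `(b - a) / 2`. -/
theorem not_isIndependentSeq_add {X : Type*} [TopologicalSpace X] [CompactSpace X]
    {F G : Set (X → ℝ)} (hFc : ∀ f ∈ F, Continuous f) (hGc : ∀ g ∈ G, Continuous g)
    (hFb : IsBoundedFamily F) (hGb : IsBoundedFamily G)
    (hF : ¬ ∃ f : ℕ → X → ℝ, (∀ n, f n ∈ F) ∧ IsIndependentSeq f)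
    (hG : ¬ ∃ g : ℕ → X → ℝ, (∀ n, g n ∈ G) ∧ IsIndependentSeq g)
    {u v : ℕ → X → ℝ} (hu : ∀ n, u n ∈ F) (hv : ∀ n, v n ∈ G) :
    ¬ IsIndependentSeq fun n => u n + v n := by
  rintro ⟨a, b, hab, h⟩
  have hδ : 0 < (b - a) / 2 := by linarith
  obtain ⟨L, hL, hLu⟩ := exists_strictMono_mapClusterPt_lt hFb hF hu hδ
  obtain ⟨L', hL', hLv⟩ :=
    exists_strictMono_mapClusterPt_lt hGb hG (f := fun n => v (L n)) (fun n => hv _) hδ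
  obtain ⟨x, hx⟩ := IsIndependentSeq.exists_forall_le_forall_ge
    (fun n => (hFc _ (hu n)).add (hGc _ (hv n))) h (hL.comp hL').injective
  obtain ⟨C, hC⟩ := hFb
  obtain ⟨D, hD⟩ := hGb
  have hsub : ∀ φ : ℕ → ℕ, ∃ (p q : ℝ) (θ : ℕ → ℕ), StrictMono θ ∧
      Tendsto (fun n => u (L (L' (φ (θ n)))) x) atTop (𝓝 p) ∧
      Tendsto (fun n => v (L (L' (φ (θ n)))) x) atTop (𝓝 q) := fun φ => by
    obtain ⟨⟨p, q⟩, -, θ, hθ, hlim⟩ := ((isCompact_Icc (a := -C) (b := C)).prod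
      (isCompact_Icc (a := -D) (b := D))).tendsto_subseq
      (x := fun n => (u (L (L' (φ n))) x, v (L (L' (φ n))) x))
      fun n => ⟨abs_le.1 (hC _ (hu _) x), abs_le.1 (hD _ (hv _) x)⟩
    exact ⟨p, q, θ, hθ, (Prod.tendsto_iff _ _).1 hlim⟩
  have he : StrictMono fun k : ℕ => 2 * k := fun i j hij => by simpa using hij
  have ho : StrictMono fun k : ℕ => 2 * k + 1 := fun i j hij => by simpa using hij
  obtain ⟨p, q, θ, hθ, hp, hq⟩ := hsub fun k => 2 * k
  obtain ⟨p', q', θ', hθ', hp', hq'⟩ := hsub fun k => 2 * k + 1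
  have h1 : p + q ≤ a := le_of_tendsto (hp.add hq) (Eventually.of_forall fun n => (hx (θ n)).1)
  have h2 : b ≤ p' + q' := ge_of_tendsto (hp'.add hq') (Eventually.of_forall fun n => (hx (θ' n)).2)
  have h3 : p' < p + (b - a) / 2 := hLu x p p'
    (hp.mapClusterPt.of_comp (hL'.comp (he.comp hθ)).tendsto_atTop)
    (hp'.mapClusterPt.of_comp (hL'.comp (ho.comp hθ')).tendsto_atTop)
  have h4 : q' < q + (b - a) / 2 := hLv x q q'
    (hq.mapClusterPt.of_comp (he.comp hθ).tendsto_atTop)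
    (hq'.mapClusterPt.of_comp (ho.comp hθ').tendsto_atTop)
  linarith

theorem IsIndependentSeq.of_forall_mem {X Y : Type*} {f : ℕ → X → ℝ} {g : ℕ → Y → ℝ}
    (hf : IsIndependentSeq f) (h : ∀ x, ∃ y, ∀ n, g n y = f n x) : IsIndependentSeq g := by
  obtain ⟨a, b, hab, hind⟩ := hf
  refine ⟨a, b, hab, fun P Q hPQ => ?_⟩
  obtain ⟨x, hx⟩ := hind P Q hPQ
  obtain ⟨y, hy⟩ := h x
  exact ⟨y, by simpa [hy] using hx⟩

theorem IsIndependentSeq.of_forall_abs_sub_lt {X : Type*} {f g : ℕ → X → ℝ} {a b ε : ℝ}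
    (hε : a + ε < b - ε) (h : ∀ P Q : Finset ℕ, Disjoint P Q →
      ((⋂ n ∈ P, g n ⁻¹' Set.Iio a) ∩ ⋂ n ∈ Q, g n ⁻¹' Set.Ioi b).Nonempty)
    (hfg : ∀ n x, |g n x - f n x| < ε) : IsIndependentSeq f := by
  refine ⟨a + ε, b - ε, hε, fun P Q hPQ => ?_⟩
  obtain ⟨x, hxP, hxQ⟩ := h P Q hPQ
  refine ⟨x, Set.mem_iInter₂.2 fun n hn => ?_, Set.mem_iInter₂.2 fun n hn => ?_⟩
  · have h1 : g n x < a := Set.mem_iInter₂.1 hxP n hn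
    have h2 := abs_lt.1 (hfg n x)
    exact (by linarith : f n x < a + ε)
  · have h1 : b < g n x := Set.mem_iInter₂.1 hxQ n hn
    have h2 := abs_lt.1 (hfg n x)
    exact (by linarith : b - ε < f n x)

theorem isAdmissibleFamilyClass_isTameFamily :
    IsAdmissibleFamilyClass.{u} fun _ _ F => IsTameFamily F where
  mono X _ F G hFG hG := ⟨hG.1.imp fun C hC f hf => hC f (hFG hf),
    fun ⟨f, hf, hind⟩ => hG.2 ⟨f, fun n => hFG (hf n), hind⟩⟩
  zero X _ := by
    refine ⟨⟨0, by rintro _ rfl x; simp⟩, ?_⟩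
    rintro ⟨f, hf, a, b, hab, hind⟩
    obtain ⟨x, hx⟩ := hind {0} {1} (by simp)
    have hf0 : ∀ n, f n = 0 := hf
    simp only [hf0, Finset.mem_singleton, Set.iInter_iInter_eq_left, Set.mem_inter_iff,
      Set.mem_preimage, Pi.zero_apply, Set.mem_Iio, Set.mem_Ioi] at hx
    linarith
  add X _ _ F G hFc hGc hFb hGb hF hG := by
    refine ⟨?_, ?_⟩
    · obtain ⟨⟨C, hC⟩, D, hD⟩ := hFb, hGb
      refine ⟨C + D, ?_⟩
      rintro _ ⟨f, hf, g, hg, rfl⟩ x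
      exact (abs_add_le _ _).trans (add_le_add (hC f hf x) (hD g hg x))
    · rintro ⟨f, hf, hind⟩
      choose u hu v hv huv using hf
      obtain rfl : (fun n => u n + v n) = f := funext huv
      exact not_isIndependentSeq_add hFc hGc hFb hGb hF.2 hG.2 hu hv hind
  comp X Y _ _ φ _ F hF := by
    refine ⟨hF.1.imp fun C hC => ?_, ?_⟩
    · rintro _ ⟨f, hf, rfl⟩ x
      exact hC f hf _
    · rintro ⟨f, hf, hind⟩
      choose u hu huf using hf
      exact hF.2 ⟨u, hu, hind.of_forall_mem fun x => ⟨φ x, fun n => congrFun (huf n) x⟩⟩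
  of_comp X Y _ _ _ _ _ φ _ hsurj F hF := by
    refine ⟨hF.1.imp fun C hC f hf x => ?_, ?_⟩
    · obtain ⟨y, rfl⟩ := hsurj x
      exact hC _ (Set.mem_image_of_mem _ hf) y
    · rintro ⟨f, hf, hind⟩
      refine hF.2 ⟨fun n => f n ∘ φ, fun n => Set.mem_image_of_mem _ (hf n),
        hind.of_forall_mem fun x => ?_⟩
      obtain ⟨y, rfl⟩ := hsurj x
      exact ⟨y, fun n => rfl⟩
  approx X _ F G hFb hFG hF := by
    refine ⟨?_, ?_⟩
    · obtain ⟨C, hC⟩ := hFb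
      refine ⟨C + 1, fun g hg x => ?_⟩
      obtain ⟨f, hf, hgf⟩ := hFG 1 one_pos g hg
      have h1 := abs_lt.1 (hgf x)
      have h2 := abs_le.1 (hC f hf x)
      exact abs_le.2 ⟨by linarith, by linarith⟩
    · rintro ⟨g, hg, a, b, hab, hind⟩
      choose f hf hgf using fun n => hFG ((b - a) / 3) (by linarith) (g n) (hg n)
      exact hF.2 ⟨f, hf, IsIndependentSeq.of_forall_abs_sub_lt (by linarith) hind hgf⟩

end TameLCS

theorem mainTheorem6 :
    (∀ 𝔅 : TameLCS.BornologicalClass.{u}, TameLCS.IsStable.{u} 𝔅.IsSmall) ∧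
    TameLCS.IsStable.{u} TameLCS.IsTame ∧
    TameLCS.IsStable.{u} TameLCS.IsNamiokaPhelps ∧
    TameLCS.IsStable.{u} TameLCS.IsDLP :=
  ⟨fun 𝔅 => 𝔅.isStable_isSmall, TameLCS.isAdmissibleFamilyClass_isTameFamily.isStable,
    TameLCS.isAdmissibleFamilyClass_isFragmentedFamily.isStable,
    TameLCS.isAdmissibleFamilyClass_hasDLP.isStable⟩
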